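/- Let $n\in\mathbb N$ and let $\mathfrak{su}(n)$ be the real vector space of skew-Hermitian complex $n\times n$ matrices of trace zero. Let $x,y\in\mathfrak{su}(n)$, let $t_1,t_2\in\mathbb R$, and suppose that for every $t\in[t_1,t_2]$ a matrix $x(t)\in\mathfrak{su}(n)$ is given with $$e^{tx}e^{y}=e^{x(t)}\in \mathrm{SU}(n)\qquad\text{and}\qquad \|x(t)\|_\infty<\frac{\pi}{2},$$ where $\|\cdot\|_\infty$ is the spectral norm (the operator norm on $\mathbb C^n$ with the Euclidean norm). Let $\|\cdot\|:\mathfrak{su}(n)\to[0,\infty)$ be any $\mathrm{Ad}$-invariant norm or, more generally, any $\mathrm{Ad}$-invariant Finsler norm: a subadditive function with $\|v\|=0$ only for $v=0$, with $\|\lambda v\|=\lambda\|v\|$ for all real $\lambda\ge 0$, and with $\|uvu^{-1}\|=\|v\|$ for all $u\in\mathrm{SU}(n)$ and $v\in\mathfrak{su}(n)$. Then the function $t\mapsto\|x(t)\|$ is convex on $[t_1,t_2]$. -/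

import Mathlib

/-- The real Lie algebra `su(n)`: skew-Hermitian complex `n × n` matrices of trace zero,
as a real vector space. -/
def su (n : ℕ) : Submodule ℝ (Matrix (Fin n) (Fin n) ℂ) where
  carrier := {A | A.conjTranspose = -A ∧ A.trace = 0}
  zero_mem' := by simp
  add_mem' := by
    rintro A B ⟨hA, hA'⟩ ⟨hB, hB'⟩
    exact ⟨by rw [Matrix.conjTranspose_add, hA, hB, neg_add],
      by rw [Matrix.trace_add, hA', hB', add_zero]⟩
  smul_mem' := by
    rintro c A ⟨hA, hA'⟩
    exact ⟨by rw [Matrix.conjTranspose_smul, hA, smul_neg, star_trivial],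
      by rw [Matrix.trace_smul, hA', smul_zero]⟩

/-- The adjoint action `Ad_u v = u v u⁻¹ = u v u*` of `SU(n)` on `su(n)`. -/
def suAd {n : ℕ} (u : Matrix.specialUnitaryGroup (Fin n) ℂ) (v : su n) : su n :=
  ⟨(u : Matrix (Fin n) (Fin n) ℂ) * v * (u : Matrix (Fin n) (Fin n) ℂ).conjTranspose, by
    obtain ⟨v, hv, hv'⟩ := v
    obtain ⟨u, hu⟩ := u
    have hu' : u.conjTranspose * u = 1 :=
      Matrix.mem_unitaryGroup_iff'.mp (Matrix.specialUnitaryGroup_le_unitaryGroup hu)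
    refine ⟨?_, ?_⟩
    · simp [Matrix.conjTranspose_mul, hv, Matrix.mul_assoc]
    · change (u * v * u.conjTranspose).trace = 0
      rw [Matrix.trace_mul_comm, ← Matrix.mul_assoc, hu', Matrix.one_mul, hv']⟩

/-- An `Ad`-invariant Finsler norm on `su(n)`: a nonnegative, nondegenerate, subadditive, positively
homogeneous function that is invariant under the adjoint action of `SU(n)`. Every `Ad`-invariant
norm is one; the equality of the values at `v` and `-v` is not required. -/
structure IsAdInvariantFinslerNorm {n : ℕ} (N : su n → ℝ) : Prop where
  nonneg : ∀ v, 0 ≤ N v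
  eq_zero_imp : ∀ v, N v = 0 → v = 0
  add_le : ∀ v w, N (v + w) ≤ N v + N w
  smul_eq : ∀ (c : ℝ) (v : su n), 0 ≤ c → N (c • v) = c * N v
  ad_eq : ∀ (u : Matrix.specialUnitaryGroup (Fin n) ℂ) (v : su n), N (suAd u v) = N v

/-- The spectral norm of a complex matrix: the operator norm of the linear map that it induces on
`ℂⁿ` with the Euclidean norm. -/
noncomputable def matrixSpectralNorm {n : ℕ} (A : Matrix (Fin n) (Fin n) ℂ) : ℝ :=
  ‖Matrix.toEuclideanCLM (n := Fin n) (𝕜 := ℂ) A‖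

open Filter Topology Asymptotics

/-! A continuous function is convex if at each interior point it lies above some affine function up
to `o(s²)`. Such a support is built at `X₀ = X t`, writing `exp (X (t + s)) = exp (s x) exp X₀`,
without differentiating `X`.

Diagonalise `X₀` with eigenvalues `i θ j` in an orthonormal basis `v j`. Hahn–Banach on diagonal
matrices, the pinching inequality and permutation invariance give weights `φ j`, ordered like the `θ
j`, with `∑ φ j θ j = N X₀` and `∑ φ j Im⟨b j, X b j⟩ ≤ N X` for every `X` and every orthonormal
basis `b` (`exists_spectral_subgradient`).

Test this on the rotated basis `b j = exp (s w) (v j)`, where `w = eigenRotation` makes each `b j`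
an eigenvector of `exp (s x) exp X₀` up to `O(s²)`. The bound `π / 2` on the spectra lets this pass
from the exponential to `X (t + s)`, and `Im⟨b j, X (t + s) b j⟩ = θ j + s h j + s² κ j + o(s²)`
(`im_inner_rotated_isLittleO`). Here `κ j = ∑ l, |w l j|² sin (θ j - θ l)`. Antisymmetrising, `∑ φ j
κ j` is half the sum of `(φ j - φ l) |w l j|² sin (θ j - θ l)`, which is nonnegative because `|θ j -
θ l| ≤ π`. Dropping it leaves the affine support. -/

/-! ### Convexity from supports up to second order -/

theorem convexOn_of_quadratic_support {f : ℝ → ℝ} {a b : ℝ}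
    (hf : ContinuousOn f (Set.Icc a b))
    (h : ∀ t ∈ Set.Ioo a b, ∃ c : ℝ, ∀ ε > 0, ∀ᶠ s in 𝓝 (0 : ℝ),
      f t + c * s - ε * s ^ 2 ≤ f (t + s)) :
    ConvexOn ℝ (Set.Icc a b) f := by
  refine LinearOrder.convexOn_of_lt (convex_Icc a b) ?_
  intro x hx y hy hxy α β hα hβ hαβ
  by_contra hcon
  push Not at hcon
  simp only [smul_eq_mul] at hcon
  set p := α * x + β * y with hp
  have hβ' : β = 1 - α := by linarith
  have hxp : x < p := by rw [hp, hβ']; nlinarith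
  have hpy : p < y := by rw [hp, hβ']; nlinarith
  set m := (f y - f x) / (y - x) with hm
  have hm' : m * (y - x) = f y - f x := div_mul_cancel₀ _ (by linarith)
  set gap := f p - (f x + m * (p - x)) with hgap
  have hgap_pos : 0 < gap := by
    have : f x + m * (p - x) = α * f x + β * f y := by
      have : p - x = β * (y - x) := by rw [hp, hβ']; ring
      rw [this, show m * (β * (y - x)) = β * (m * (y - x)) by ring, hm', hβ']; ring
    rw [hgap, this]; linarith
  have hprod : 0 < (p - x) * (y - p) := mul_pos (by linarith) (by linarith)
  -- This `η` makes `g p = gap / 2 > 0`, while `g` vanishes at `x` and `y`; hence the maximum of `g`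
  -- is interior.
  set η := gap / (2 * ((p - x) * (y - p))) with hη
  have hη_pos : 0 < η := by positivity
  have hη' : η * ((p - x) * (y - p)) = gap / 2 := by
    have h0 := hprod.ne'
    rw [hη, mul_comm 2, ← div_div, div_mul_eq_mul_div, div_mul_cancel₀ _ h0]
  set g : ℝ → ℝ := fun t => f t - (f x + m * (t - x)) + η * ((t - x) * (t - y)) with hg
  have hsub : Set.Icc x y ⊆ Set.Icc a b := Set.Icc_subset_Icc hx.1 hy.2
  have hgc : ContinuousOn g (Set.Icc x y) := by
    have := hf.mono hsub
    fun_prop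
  obtain ⟨t, ht, hmax⟩ := isCompact_Icc.exists_isMaxOn ⟨x, le_rfl, hxy.le⟩ hgc
  have hgp : 0 < g p := by
    simp only [hg]
    nlinarith [hη', hgap]
  have hgt : 0 < g t := hgp.trans_le (hmax ⟨hxp.le, hpy.le⟩)
  have hxt : x ≠ t := by rintro rfl; simp [hg] at hgt
  have hty : t ≠ y := by
    rintro rfl
    have : g t = 0 := by simp only [hg]; rw [hm']; ring
    linarith
  have hxt' : x < t := lt_of_le_of_ne ht.1 hxt
  have hty' : t < y := lt_of_le_of_ne ht.2 hty
  obtain ⟨c, hc⟩ := h t ⟨hx.1.trans_lt hxt', hty'.trans_le hy.2⟩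
  -- In `g (t + s) + g (t - s) - 2 g t` the slope `c` cancels, the parabola adds `2 η s²`, and the
  -- support with `ε = η / 2` loses at most `η s²`: a contradiction at a maximum.
  obtain ⟨δ, hδ, hball⟩ := Metric.eventually_nhds_iff.mp (hc (η / 2) (by positivity))
  set s := min (δ / 2) (min (t - x) (y - t)) with hs
  have hs0 : 0 < s := lt_min (by linarith) (lt_min (by linarith) (by linarith))
  have hsδ : s < δ := (min_le_left _ _).trans_lt (by linarith)
  have hs1 : s ≤ t - x := (min_le_right _ _).trans (min_le_left _ _)
  have hs2 : s ≤ y - t := (min_le_right _ _).trans (min_le_right _ _)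
  have h1 := hball (y := s) (by rwa [Real.dist_eq, sub_zero, abs_of_pos hs0])
  have h2 := hball (y := -s) (by rwa [Real.dist_eq, sub_zero, abs_neg, abs_of_pos hs0])
  have m1 : g (t + s) ≤ g t := hmax ⟨by linarith, by linarith⟩
  have m2 : g (t + -s) ≤ g t := hmax ⟨by linarith, by linarith⟩
  simp only [hg] at m1 m2
  nlinarith [mul_pos hη_pos (pow_pos hs0 2)]

/-! ### Second order Taylor expansions -/

/-- The second order expansion `f s = f₀ + s f₁ + s² f₂ + o(s²)` at `s = 0`. -/
def HasTaylorTwo {E : Type*} [NormedAddCommGroup E] [NormedSpace ℝ E] (f : ℝ → E)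
    (f₀ f₁ f₂ : E) : Prop :=
  (fun s : ℝ => f s - (f₀ + s • f₁ + s ^ 2 • f₂)) =o[𝓝 0] fun s : ℝ => s ^ 2

namespace HasTaylorTwo

variable {E F G : Type*} [NormedAddCommGroup E] [NormedSpace ℝ E]
  [NormedAddCommGroup F] [NormedSpace ℝ F] [NormedAddCommGroup G] [NormedSpace ℝ G]

theorem tendsto_taylor (f₀ f₁ f₂ : E) :
    Tendsto (fun s : ℝ => f₀ + s • f₁ + s ^ 2 • f₂) (𝓝 0) (𝓝 f₀) := by
  have : Continuous (fun s : ℝ => f₀ + s • f₁ + s ^ 2 • f₂) := by fun_prop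
  simpa using this.tendsto 0

theorem const (f₀ : E) : HasTaylorTwo (fun _ => f₀) f₀ 0 0 := by
  simp [HasTaylorTwo]

theorem tendsto {f : ℝ → E} {f₀ f₁ f₂ : E} (hf : HasTaylorTwo f f₀ f₁ f₂) :
    Tendsto f (𝓝 0) (𝓝 f₀) := by
  have h0 : Tendsto (fun s : ℝ => s ^ 2) (𝓝 0) (𝓝 0) := by
    simpa using (continuous_pow 2).tendsto (0 : ℝ)
  have := (hf.trans_tendsto h0).add (tendsto_taylor f₀ f₁ f₂)
  simpa using this

theorem sub {f g : ℝ → E} {f₀ f₁ f₂ g₀ g₁ g₂ : E} (hf : HasTaylorTwo f f₀ f₁ f₂)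
    (hg : HasTaylorTwo g g₀ g₁ g₂) :
    HasTaylorTwo (fun s => f s - g s) (f₀ - g₀) (f₁ - g₁) (f₂ - g₂) := by
  refine (IsLittleO.sub hf hg).congr_left fun s => ?_
  simp only [smul_sub]; abel

theorem clm (L : E →L[ℝ] F) {f : ℝ → E} {f₀ f₁ f₂ : E} (hf : HasTaylorTwo f f₀ f₁ f₂) :
    HasTaylorTwo (fun s => L (f s)) (L f₀) (L f₁) (L f₂) := by
  refine ((L.isBigO_comp _ _).trans_isLittleO hf).congr_left fun s => ?_
  simp

theorem bilinear {B : E × F → G} (hB : IsBoundedBilinearMap ℝ B) {f : ℝ → E} {g : ℝ → F}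
    {f₀ f₁ f₂ : E} {g₀ g₁ g₂ : F} (hf : HasTaylorTwo f f₀ f₁ f₂)
    (hg : HasTaylorTwo g g₀ g₁ g₂) :
    HasTaylorTwo (fun s => B (f s, g s)) (B (f₀, g₀)) (B (f₀, g₁) + B (f₁, g₀))
      (B (f₀, g₂) + B (f₁, g₁) + B (f₂, g₀)) := by
  obtain ⟨C, -, hC⟩ := hB.bound
  have key : ∀ {u : ℝ → E} {v : ℝ → F}, (fun s => B (u s, v s)) =O[𝓝 0]
      fun s => ‖u s‖ * ‖v s‖ := fun {u v} =>
    IsBigO.of_bound C (Eventually.of_forall fun s => by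
      simpa [mul_assoc] using hC (u s) (v s))
  -- With Taylor polynomials `P`, `Q`: `B (f, g) = B (f - P, g) + B (P, g - Q) + B (P, Q)`, and `h3`
  -- disposes of the terms of `B (P, Q)` of order at least three.
  have h1 : (fun s => B (f s - (f₀ + s • f₁ + s ^ 2 • f₂), g s)) =o[𝓝 0] fun s : ℝ => s ^ 2 := by
    refine key.trans_isLittleO ?_
    simpa using (IsLittleO.norm_left hf).mul_isBigO (hg.tendsto.norm.isBigO_one ℝ)
  have h2 : (fun s => B (f₀ + s • f₁ + s ^ 2 • f₂, g s - (g₀ + s • g₁ + s ^ 2 • g₂))) =o[𝓝 0]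
      fun s : ℝ => s ^ 2 := by
    refine key.trans_isLittleO ?_
    simpa using ((tendsto_taylor f₀ f₁ f₂).norm.isBigO_one ℝ).mul_isLittleO
      (IsLittleO.norm_left hg)
  have h3 : (fun s : ℝ => s ^ 2 • (s • (B (f₁, g₂) + B (f₂, g₁)) + s ^ 2 • B (f₂, g₂))) =o[𝓝 0]
      fun s : ℝ => s ^ 2 := by
    have : Tendsto (fun s : ℝ => s • (B (f₁, g₂) + B (f₂, g₁)) + s ^ 2 • B (f₂, g₂))
        (𝓝 0) (𝓝 0) := by
      have : Continuous (fun s : ℝ => s • (B (f₁, g₂) + B (f₂, g₁)) + s ^ 2 • B (f₂, g₂)) := by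
        fun_prop
      simpa using this.tendsto 0
    simpa using (isBigO_refl (fun s : ℝ => s ^ 2) (𝓝 0)).smul_isLittleO
      ((isLittleO_one_iff ℝ).2 this)
  refine ((h1.add h2).add h3).congr_left fun s => ?_
  have e1 : ∀ x x' y, B (x - x', y) = B (x, y) - B (x', y) := fun x x' y => hB.map_sub_left
  have e2 : ∀ x y y', B (x, y - y') = B (x, y) - B (x, y') := fun x y y' => hB.map_sub_right
  simp only [e1, e2, hB.add_left, hB.add_right, hB.smul_left, hB.smul_right]
  module

theorem isBigO_sq {f : ℝ → E} {f₂ : E} (hf : HasTaylorTwo f 0 0 f₂) :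
    f =O[𝓝 0] fun s : ℝ => s ^ 2 := by
  have h : (fun s : ℝ => s ^ 2 • f₂) =O[𝓝 0] fun s : ℝ => s ^ 2 := by
    simpa using (isBigO_refl (fun s : ℝ => s ^ 2) (𝓝 0)).smul (isBigO_const_const f₂
      (one_ne_zero (α := ℝ)) (𝓝 0))
  refine ((IsLittleO.isBigO hf).add h).congr_left fun s => ?_
  simp

theorem exp_smul {𝔸 : Type*} [NormedRing 𝔸] [NormedAlgebra ℝ 𝔸] [CompleteSpace 𝔸] (a : 𝔸) :
    HasTaylorTwo (fun s => NormedSpace.exp (s • a)) 1 a ((2⁻¹ : ℝ) • (a * a)) := by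
  have h := (NormedSpace.exp_hasFPowerSeriesAt_zero (𝕂 := ℝ) (𝔸 := 𝔸)).isBigO_sub_partialSum_pow 3
  have hlin : Tendsto (fun s : ℝ => s • a) (𝓝 0) (𝓝 0) := by
    have : Continuous (fun s : ℝ => s • a) := by fun_prop
    simpa using this.tendsto 0
  have h' := h.comp_tendsto hlin
  have h3 : (fun s : ℝ => ‖s • a‖ ^ 3) =O[𝓝 0] fun s : ℝ => s ^ 3 := by
    refine IsBigO.of_bound (‖a‖ ^ 3) (Eventually.of_forall fun s => ?_)
    simp [norm_smul, mul_pow, mul_comm]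
  have h4 : (fun s : ℝ => s ^ 3) =o[𝓝 0] fun s : ℝ => s ^ 2 :=
    isLittleO_pow_pow (by norm_num)
  refine ((h'.trans h3).trans_isLittleO h4).congr_left fun s => ?_
  simp [FormalMultilinearSeries.partialSum, Finset.sum_range_succ,
    NormedSpace.expSeries_apply_eq, pow_two, smul_smul]
  module

end HasTaylorTwo

/-! ### Comparing a skew-adjoint operator with its exponential -/

theorem Real.abs_sub_sin_le_two_mul_sq (z : ℝ) : |z - Real.sin z| ≤ 2 * z ^ 2 := by
  wlog hz : 0 ≤ z generalizing z
  · have := this (-z) (by linarith)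
    rwa [Real.sin_neg, neg_sq, show -z - -Real.sin z = -(z - Real.sin z) by ring, abs_neg] at this
  rcases hz.eq_or_lt with rfl | hz
  · simp
  rcases le_or_gt z 1 with h1 | h1
  · rw [abs_of_nonneg (by linarith [Real.sin_le hz.le])]
    have := Real.sin_gt_sub_cube hz
    nlinarith [mul_pos hz hz, mul_le_mul_of_nonneg_left h1 (mul_pos hz hz).le]
  · have := Real.sin_le hz.le
    have := Real.neg_one_le_sin z
    rw [abs_of_nonneg (by linarith)]
    nlinarith

/-- The chord has length `2 |sin ((α - β) / 2)|`, and Jordan's inequality bounds the sine from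
below. -/
theorem abs_sub_le_norm_cexp_sub {α β : ℝ} (h : |α - β| ≤ Real.pi) :
    |α - β| ≤ Real.pi / 2 * ‖Complex.exp (α * Complex.I) - Complex.exp (β * Complex.I)‖ := by
  have e : Complex.exp (α * Complex.I) - Complex.exp (β * Complex.I) =
      Complex.exp (β * Complex.I) * (Complex.exp (Complex.I * (α - β : ℝ)) - 1) := by
    rw [mul_sub, ← Complex.exp_add, mul_one]
    congr 2
    push_cast
    ring
  rw [e, norm_mul, Complex.norm_exp_ofReal_mul_I, one_mul,
    Complex.norm_exp_I_mul_ofReal_sub_one, norm_mul, Real.norm_eq_abs, Real.norm_eq_abs]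
  have hhalf : |(α - β) / 2| = |α - β| / 2 := by rw [abs_div, abs_two]
  have hs := Real.mul_abs_le_abs_sin (x := (α - β) / 2) (by rw [hhalf]; linarith)
  rw [hhalf] at hs
  rw [abs_two]
  have hπ := Real.pi_pos
  calc |α - β| = Real.pi / 2 * (2 * (2 / Real.pi * (|α - β| / 2))) := by field_simp
    _ ≤ _ := by gcongr

section EigenbasisEstimates

variable {ι E : Type*} [Fintype ι] [NormedAddCommGroup E] [InnerProductSpace ℂ E]

theorem OrthonormalBasis.inner_apply_of_eigenvector (b : OrthonormalBasis ι ℂ E) {L : E →L[ℂ] E}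
    {c : ι → ℂ} (hL : ∀ k, L (b k) = c k • b k) (k : ι) (v : E) :
    inner ℂ (b k) (L v) = c k * inner ℂ (b k) v := by
  classical
  conv_lhs => rw [← b.sum_repr v]
  simp [hL, orthonormal_iff_ite.mp b.orthonormal, b.repr_apply_apply,
    mul_comm]

theorem OrthonormalBasis.norm_sq_apply_of_eigenvector (b : OrthonormalBasis ι ℂ E)
    {L : E →L[ℂ] E} {c : ι → ℂ} (hL : ∀ k, L (b k) = c k • b k) (v : E) :
    ‖L v‖ ^ 2 = ∑ k, ‖c k‖ ^ 2 * ‖inner ℂ (b k) v‖ ^ 2 := by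
  simp [← b.sum_sq_norm_inner_right (L v), b.inner_apply_of_eigenvector hL, mul_pow]

theorem OrthonormalBasis.inner_self_apply_of_eigenvector (b : OrthonormalBasis ι ℂ E)
    {L : E →L[ℂ] E} {c : ι → ℂ} (hL : ∀ k, L (b k) = c k • b k) (v : E) :
    inner ℂ v (L v) = ∑ k, c k * (‖inner ℂ (b k) v‖ ^ 2 : ℝ) := by
  rw [← b.sum_inner_mul_inner]
  refine Finset.sum_congr rfl fun k _ => ?_
  rw [b.inner_apply_of_eigenvector hL, mul_left_comm, ← inner_conj_symm v (b k),
    RCLike.conj_mul]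
  push_cast
  rfl

theorem ContinuousLinearMap.exp_apply_of_eigenvector [CompleteSpace E] {A : E →L[ℂ] E} {c : ℂ}
    {v : E} (h : A v = c • v) : NormedSpace.exp A v = Complex.exp c • v := by
  have h1 := (NormedSpace.exp_series_hasSum_exp' (𝕂 := ℂ) A).mapL (ContinuousLinearMap.apply ℂ E v)
  have h2 := (NormedSpace.exp_series_hasSum_exp' (𝕂 := ℂ) c).smul_const v
  have hpow : ∀ m : ℕ, (A ^ m) v = c ^ m • v := fun m => by
    induction m with
    | zero => simp
    | succ m ih => rw [pow_succ', mul_apply_eq_comp, ih, map_smul, h, smul_smul, pow_succ]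
  rw [Complex.exp_eq_exp_ℂ]
  refine h1.unique ?_
  convert h2 using 2 with m
  simp [hpow, smul_smul]

/-- This replaces the logarithm: an approximate eigenvector of `exp A` is one of `A`. In the
eigenbasis both sides are diagonal, and the chord bound applies to each coefficient. -/
theorem OrthonormalBasis.norm_sub_le_norm_exp_sub [CompleteSpace E] (b : OrthonormalBasis ι ℂ E)
    {A : E →L[ℂ] E} {μ : ι → ℝ} (hA : ∀ k, A (b k) = (μ k * Complex.I) • b k)
    (hμ : ∀ k, |μ k| ≤ Real.pi / 2) {α : ℝ} (hα : |α| ≤ Real.pi / 2) (v : E) :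
    ‖A v - (α * Complex.I) • v‖ ≤
      Real.pi / 2 * ‖NormedSpace.exp A v - Complex.exp (α * Complex.I) • v‖ := by
  have h1 : ∀ k, (A - (α * Complex.I) • (1 : E →L[ℂ] E)) (b k) =
      (μ k * Complex.I - α * Complex.I) • b k := fun k => by simp [hA, sub_smul]
  have h2 : ∀ k, (NormedSpace.exp A - Complex.exp (α * Complex.I) • (1 : E →L[ℂ] E)) (b k) =
      (Complex.exp (μ k * Complex.I) - Complex.exp (α * Complex.I)) • b k := fun k => by
    simp [ContinuousLinearMap.exp_apply_of_eigenvector (hA k), sub_smul]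
  have e1 := b.norm_sq_apply_of_eigenvector h1 v
  have e2 := b.norm_sq_apply_of_eigenvector h2 v
  have hπ := Real.pi_pos
  simp only [sub_apply, smul_apply,
    one_apply_eq_self] at e1 e2
  refine (sq_le_sq₀ (norm_nonneg _) (by positivity)).mp ?_
  rw [mul_pow, e1, e2, Finset.mul_sum]
  refine Finset.sum_le_sum fun k _ => ?_
  rw [← mul_assoc, ← mul_pow (Real.pi / 2)]
  refine mul_le_mul_of_nonneg_right (pow_le_pow_left₀ (norm_nonneg _) ?_ 2) (sq_nonneg _)
  rw [← sub_mul, norm_mul, Complex.norm_I, mul_one, ← Complex.ofReal_sub, Complex.norm_real,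
    Real.norm_eq_abs]
  refine abs_sub_le_norm_cexp_sub ?_
  have := abs_sub (μ k) α
  linarith [hμ k]

/-- In the eigenbasis the error is the average of `z - sin z`, `z = μ k - α`, with weights `|⟨b k,
v⟩|²`. It is quadratic in the eigenvector defect, so a defect `O(s²)` costs only `O(s⁴)`. -/
theorem OrthonormalBasis.abs_im_inner_sub_le [CompleteSpace E] (b : OrthonormalBasis ι ℂ E)
    {A : E →L[ℂ] E} {μ : ι → ℝ} (hA : ∀ k, A (b k) = (μ k * Complex.I) • b k) (α : ℝ) (v : E) :
    |(inner ℂ v (A v)).im - α * ‖v‖ ^ 2 -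
        (Complex.exp (-(α * Complex.I)) * inner ℂ v (NormedSpace.exp A v)).im| ≤
      2 * ‖A v - (α * Complex.I) • v‖ ^ 2 := by
  have h1 : ∀ k, (A - (α * Complex.I) • (1 : E →L[ℂ] E)) (b k) =
      (μ k * Complex.I - α * Complex.I) • b k := fun k => by simp [hA, sub_smul]
  have e1 := b.norm_sq_apply_of_eigenvector h1 v
  simp only [sub_apply, smul_apply,
    one_apply_eq_self] at e1
  rw [e1, b.inner_self_apply_of_eigenvector hA, b.inner_self_apply_of_eigenvector
    (fun k => ContinuousLinearMap.exp_apply_of_eigenvector (hA k)), ← b.sum_sq_norm_inner_right v,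
    Finset.mul_sum, Finset.mul_sum, Complex.im_sum, Complex.im_sum, ← Finset.sum_sub_distrib,
    ← Finset.sum_sub_distrib, Finset.mul_sum]
  refine (Finset.abs_sum_le_sum_abs _ _).trans (Finset.sum_le_sum fun k _ => ?_)
  have e2 : Complex.exp (-(α * Complex.I)) * (Complex.exp (μ k * Complex.I) *
      (‖inner ℂ (b k) v‖ ^ 2 : ℝ)) = Complex.exp ((μ k - α : ℝ) * Complex.I) *
      (‖inner ℂ (b k) v‖ ^ 2 : ℝ) := by
    rw [← mul_assoc, ← Complex.exp_add]
    congr 2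
    push_cast
    ring
  rw [e2, Complex.im_mul_ofReal, Complex.im_mul_ofReal, Complex.exp_ofReal_mul_I_im,
    ← sub_mul (μ k : ℂ), norm_mul, Complex.norm_I, mul_one, ← Complex.ofReal_sub, Complex.norm_real,
    Real.norm_eq_abs, sq_abs]
  have e3 : (μ k * Complex.I : ℂ).im = μ k := by simp
  rw [e3, ← sub_mul, ← sub_mul, abs_mul, abs_of_nonneg (sq_nonneg ‖inner ℂ (b k) v‖), ← mul_assoc]
  exact mul_le_mul_of_nonneg_right (Real.abs_sub_sin_le_two_mul_sq _) (sq_nonneg _)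

end EigenbasisEstimates

/-! ### Eigenbases adapted to a perturbation -/

/-- As in degenerate perturbation theory, diagonalise the compression of `H` to each eigenspace of
`T` and collect the bases. The first order equation for `eigenRotation` is solvable only when these
entries vanish. -/
theorem LinearMap.IsSymmetric.exists_eigenbasis_compression_diagonal {E : Type*}
    [NormedAddCommGroup E] [InnerProductSpace ℂ E] [FiniteDimensional ℂ E] {n : ℕ}
    (hn : Module.finrank ℂ E = n) {T H : E →ₗ[ℂ] E} (hT : T.IsSymmetric) (hH : H.IsSymmetric) :
    ∃ (v : OrthonormalBasis (Fin n) ℂ E) (θ : Fin n → ℝ), (∀ j, T (v j) = (θ j : ℂ) • v j) ∧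
      ∀ j l, j ≠ l → θ j = θ l → inner ℂ (v l) (H (v j)) = 0 := by
  classical
  let A : Module.End.Eigenvalues T → Submodule ℂ E := fun μ => Module.End.eigenspace T μ
  let HW : ∀ μ, A μ →ₗ[ℂ] A μ := fun μ =>
    (A μ).orthogonalProjectionOnto.toLinearMap ∘ₗ H ∘ₗ (A μ).subtype
  have hHW : ∀ μ, (HW μ).IsSymmetric := fun μ x y => by
    have h1 : inner ℂ (HW μ x) y = inner ℂ (H x) (y : E) :=
      Submodule.inner_orthogonalProjectionOnto_eq_of_mem_right y (H x)
    have h2 : inner ℂ x (HW μ y) = inner ℂ (x : E) (H y) :=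
      Submodule.inner_orthogonalProjectionOnto_eq_of_mem_left x (H y)
    rw [h1, h2, hH]
  let B := fun μ => (hHW μ).eigenvectorBasis rfl
  let v' := DirectSum.IsInternal.collectedOrthonormalBasis hT.orthogonalFamily_eigenspaces'
    hT.direct_sum_isInternal B
  have hv' : ∀ a, v' a = (B a.1 a.2 : E) := fun a => by
    simp [v', DirectSum.IsInternal.collectedOrthonormalBasis]
  have hcard : Fintype.card ((μ : Module.End.Eigenvalues T) × Fin (Module.finrank ℂ (A μ))) = n := by
    rw [← Module.finrank_eq_card_basis v'.toBasis, hn]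
  let e := Fintype.equivFinOfCardEq hcard
  have hreal : ∀ μ : Module.End.Eigenvalues T, ((μ : ℂ).re : ℂ) = μ := fun μ =>
    Complex.conj_eq_iff_re.mp (hT.conj_eigenvalue_eq_self μ.2)
  refine ⟨v'.reindex e, fun j => ((e.symm j).1 : ℂ).re, fun j => ?_, fun j l hjl hθ => ?_⟩
  · rw [hreal, OrthonormalBasis.reindex_apply, hv']
    exact Module.End.mem_eigenspace_iff.mp (B (e.symm j).1 (e.symm j).2).2
  · simp only [OrthonormalBasis.reindex_apply, hv']
    have hne : e.symm j ≠ e.symm l := fun h => hjl (e.symm.injective h)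
    replace hθ : ((e.symm j).1 : ℂ).re = ((e.symm l).1 : ℂ).re := hθ
    revert hne hθ
    generalize e.symm j = a
    generalize e.symm l = a'
    obtain ⟨μ, i⟩ := a
    obtain ⟨μ', i'⟩ := a'
    intro hne hθ
    have hμ : μ = μ' :=
      Subtype.ext ((hreal μ).symm.trans ((congrArg Complex.ofReal hθ).trans (hreal μ')))
    subst hμ
    have hii : i' ≠ i := by
      rintro rfl
      exact hne rfl
    have h1 : inner ℂ (B μ i') (HW μ (B μ i)) = inner ℂ (B μ i' : E) (H (B μ i)) :=
      Submodule.inner_orthogonalProjectionOnto_eq_of_mem_left (B μ i') (H (B μ i))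
    rw [← h1]
    simp only [B, LinearMap.IsSymmetric.apply_eigenvectorBasis]
    rw [inner_smul_right, ((hHW μ).eigenvectorBasis rfl).inner_eq_zero hii, mul_zero]

/-! ### Unitary invariance and pinching -/

/-- Conjugation of `su(n)` by a unitary matrix. -/
def suConj {n : ℕ} (u : Matrix.unitaryGroup (Fin n) ℂ) (v : su n) : su n :=
  ⟨(u : Matrix (Fin n) (Fin n) ℂ) * v * (u : Matrix (Fin n) (Fin n) ℂ).conjTranspose, by
    obtain ⟨v, hv, hv'⟩ := v
    obtain ⟨u, hu⟩ := u
    have hu' : u.conjTranspose * u = 1 := Matrix.mem_unitaryGroup_iff'.mp hu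
    refine ⟨?_, ?_⟩
    · simp [Matrix.conjTranspose_mul, hv, Matrix.mul_assoc]
    · change (u * v * u.conjTranspose).trace = 0
      rw [Matrix.trace_mul_comm, ← Matrix.mul_assoc, hu', Matrix.one_mul, hv']⟩

/-- Conjugation ignores scalar phases, and dividing `u` by an `n`-th root of its determinant puts it
in `SU(n)`. -/
theorem IsAdInvariantFinslerNorm.suConj_eq {n : ℕ} {N : su n → ℝ} (hN : IsAdInvariantFinslerNorm N)
    (u : Matrix.unitaryGroup (Fin n) ℂ) (v : su n) : N (suConj u v) = N v := by
  rcases Nat.eq_zero_or_pos n with rfl | hn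
  · congr 1
    exact Subtype.ext (Matrix.ext fun i => i.elim0)
  obtain ⟨c, hc⟩ := IsAlgClosed.exists_pow_nat_eq (Matrix.det (u : Matrix (Fin n) (Fin n) ℂ)) hn
  have hdet : ‖Matrix.det (u : Matrix (Fin n) (Fin n) ℂ)‖ = 1 :=
    CStarRing.norm_of_mem_unitary (Matrix.det_of_mem_unitary u.2)
  have hcn : ‖c‖ = 1 := by
    rw [← hc, norm_pow] at hdet
    exact (pow_eq_one_iff_of_nonneg (norm_nonneg _) hn.ne').mp hdet
  have hc0 : c ≠ 0 := norm_ne_zero_iff.mp (by rw [hcn]; exact one_ne_zero)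
  have hcc : c⁻¹ * star c⁻¹ = 1 := by
    rw [Complex.star_def, Complex.mul_conj, Complex.normSq_eq_norm_sq, norm_inv, hcn]; simp
  have huu : (u : Matrix (Fin n) (Fin n) ℂ) * (u : Matrix (Fin n) (Fin n) ℂ).conjTranspose = 1 :=
    Matrix.mem_unitaryGroup_iff.mp u.2
  let w : Matrix.specialUnitaryGroup (Fin n) ℂ := ⟨c⁻¹ • (u : Matrix (Fin n) (Fin n) ℂ), by
    refine Matrix.mem_specialUnitaryGroup_iff.mpr ⟨Matrix.mem_unitaryGroup_iff.mpr ?_, ?_⟩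
    · rw [Matrix.star_eq_conjTranspose, Matrix.conjTranspose_smul, Matrix.smul_mul, Matrix.mul_smul,
        smul_smul, hcc, one_smul, huu]
    · rw [Matrix.det_smul, Fintype.card_fin, ← hc, inv_pow, inv_mul_cancel₀ (pow_ne_zero _ hc0)]⟩
  rw [← hN.ad_eq w v]
  congr 1
  apply Subtype.ext
  simp only [suConj, suAd, w, Matrix.conjTranspose_smul, Matrix.smul_mul, Matrix.mul_smul, smul_smul]
  rw [mul_comm, hcc, one_smul]

/-- The matrix `Y` with the off-diagonal entries in the rows and columns in `S` replaced by `0`. -/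
def suPinch {n : ℕ} (S : Finset (Fin n)) (Y : su n) : su n :=
  ⟨Matrix.of fun i j => if i ≠ j ∧ (i ∈ S ∨ j ∈ S) then 0 else (Y : Matrix (Fin n) (Fin n) ℂ) i j,
    by
    obtain ⟨Y, hY, hY'⟩ := Y
    refine ⟨?_, ?_⟩
    · ext i j
      have := congrFun (congrFun hY i) j
      simp only [Matrix.conjTranspose_apply, Matrix.neg_apply, Matrix.of_apply] at this ⊢
      split_ifs with h1 h2 h2
      · simp
      · exact absurd ⟨h1.1.symm, h1.2.symm⟩ h2
      · exact absurd ⟨h2.1.symm, h2.2.symm⟩ h1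
      · exact this
    · simpa [Matrix.trace] using hY'⟩

/-- Clearing one row and column off the diagonal is averaging with the conjugate by the reflection
that flips that coordinate; invariance and subadditivity then suffice. -/
theorem IsAdInvariantFinslerNorm.suPinch_le {n : ℕ} {N : su n → ℝ}
    (hN : IsAdInvariantFinslerNorm N) (S : Finset (Fin n)) (Y : su n) : N (suPinch S Y) ≤ N Y := by
  induction S using Finset.induction_on with
  | empty =>
    refine (congrArg N (Subtype.ext ?_)).le
    ext i j
    simp [suPinch]
  | insert k S hk ih =>
    refine le_trans ?_ ih
    let D : Matrix (Fin n) (Fin n) ℂ := Matrix.diagonal fun i => if i = k then -1 else 1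
    have hDs : D.conjTranspose = D := by
      rw [Matrix.diagonal_conjTranspose]
      congr 1
      ext i
      by_cases h : i = k <;> simp [h]
    let u : Matrix.unitaryGroup (Fin n) ℂ := ⟨D, by
      rw [Matrix.mem_unitaryGroup_iff, Matrix.star_eq_conjTranspose, hDs, Matrix.diagonal_mul_diagonal,
        ← Matrix.diagonal_one]
      congr 1
      ext i
      by_cases h : i = k <;> simp [h]⟩
    have key : suPinch (insert k S) Y = (2⁻¹ : ℝ) • (suPinch S Y + suConj u (suPinch S Y)) := by
      apply Subtype.ext
      ext i j
      simp only [suPinch, suConj, u, hDs, D, Submodule.coe_smul, Submodule.coe_add,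
        Matrix.smul_apply, Matrix.add_apply, Matrix.mul_diagonal, Matrix.diagonal_mul,
        Matrix.of_apply, Finset.mem_insert]
      by_cases hi : i = k <;> by_cases hj : j = k <;> by_cases hij : i = j <;>
        by_cases hiS : i ∈ S <;> by_cases hjS : j ∈ S <;> simp_all <;> ring
    rw [key, hN.smul_eq _ _ (by norm_num)]
    have := hN.add_le (suPinch S Y) (suConj u (suPinch S Y))
    rw [hN.suConj_eq] at this
    linarith

/-- The diagonal matrix with entries `i (dⱼ - m)`, where `m` is the mean of the `dⱼ`. -/
noncomputable def suDiagonal (n : ℕ) : (Fin n → ℝ) →ₗ[ℝ] su n where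
  toFun d := ⟨Matrix.diagonal fun j => ((d j - (∑ k, d k) / n : ℝ) : ℂ) * Complex.I, by
    refine ⟨?_, ?_⟩
    · rw [Matrix.diagonal_conjTranspose, Matrix.diagonal_neg]
      congr 1
      ext i
      simp
    · rw [Matrix.trace_diagonal, ← Finset.sum_mul, ← Complex.ofReal_sum, Finset.sum_sub_distrib]
      rcases Nat.eq_zero_or_pos n with rfl | hn
      · simp
      · have : (n : ℝ) ≠ 0 := by positivity
        simp [mul_div_cancel₀ _ this]⟩
  map_add' d e := by
    apply Subtype.ext
    ext i j
    by_cases h : i = j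
    · subst h
      simp [Finset.sum_add_distrib]
      ring
    · simp [h]
  map_smul' c d := by
    apply Subtype.ext
    ext i j
    by_cases h : i = j
    · subst h
      simp [← Finset.mul_sum]
      ring
    · simp [h]

theorem suDiagonal_of_sum_eq_zero {n : ℕ} {d : Fin n → ℝ} (hd : ∑ j, d j = 0) :
    (suDiagonal n d : Matrix (Fin n) (Fin n) ℂ) =
      Matrix.diagonal fun j => (d j : ℂ) * Complex.I := by
  change (Matrix.diagonal fun j => ((d j - (∑ k, d k) / n : ℝ) : ℂ) * Complex.I) = _
  simp only [hd, zero_div, sub_zero]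

/-- The unitary matrix whose columns are the vectors of an orthonormal basis. -/
noncomputable def OrthonormalBasis.toUnitaryGroup {n : ℕ}
    (b : OrthonormalBasis (Fin n) ℂ (EuclideanSpace ℂ (Fin n))) : Matrix.unitaryGroup (Fin n) ℂ :=
  ⟨Matrix.of fun i j => b j i, by
    rw [Matrix.mem_unitaryGroup_iff']
    ext j k
    rw [Matrix.star_eq_conjTranspose, Matrix.mul_apply, Matrix.one_apply,
      ← orthonormal_iff_ite.mp b.orthonormal j k, PiLp.inner_apply]
    simp [mul_comm]⟩

theorem suConj_star_apply {n : ℕ} (b : OrthonormalBasis (Fin n) ℂ (EuclideanSpace ℂ (Fin n)))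
    (X : su n) (j k : Fin n) :
    (suConj (star b.toUnitaryGroup) X : Matrix (Fin n) (Fin n) ℂ) j k =
      inner ℂ (b j) (Matrix.toEuclideanCLM (n := Fin n) (𝕜 := ℂ) (X : Matrix (Fin n) (Fin n) ℂ) (b k)) := by
  simp only [suConj, OrthonormalBasis.toUnitaryGroup]
  rw [PiLp.inner_apply]
  simp [Matrix.mul_apply, Matrix.star_apply, Matrix.mulVec, dotProduct]
  simp_rw [Finset.sum_mul]
  rw [Finset.sum_comm]
  refine Finset.sum_congr rfl fun _ _ => Finset.sum_congr rfl fun _ _ => by ring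

theorem suConj_star_eq_suDiagonal {n : ℕ}
    {b : OrthonormalBasis (Fin n) ℂ (EuclideanSpace ℂ (Fin n))} {X : su n} {θ : Fin n → ℝ}
    (h : ∀ j k, inner ℂ (b j)
      (Matrix.toEuclideanCLM (n := Fin n) (𝕜 := ℂ) (X : Matrix (Fin n) (Fin n) ℂ) (b k)) =
        if j = k then (θ j : ℂ) * Complex.I else 0) :
    suConj (star b.toUnitaryGroup) X = suDiagonal n θ := by
  have htr : (suConj (star b.toUnitaryGroup) X : Matrix (Fin n) (Fin n) ℂ).trace = 0 :=
    (suConj (star b.toUnitaryGroup) X).2.2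
  -- The trace condition makes the mean zero, so the centring in `suDiagonal` changes nothing.
  have hsum : ∑ k, θ k = 0 := by
    have h1 : ((∑ k, θ k : ℝ) : ℂ) * Complex.I = 0 := by
      rw [← htr, Matrix.trace, Complex.ofReal_sum, Finset.sum_mul]
      refine Finset.sum_congr rfl fun k _ => ?_
      rw [Matrix.diag_apply, suConj_star_apply, h, if_pos rfl]
    exact Complex.ofReal_eq_zero.mp ((mul_eq_zero.mp h1).resolve_right Complex.I_ne_zero)
  apply Subtype.ext
  ext j k
  rw [suConj_star_apply, h, suDiagonal_of_sum_eq_zero hsum, Matrix.diagonal_apply]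

theorem suPinch_suConj_star {n : ℕ} (b : OrthonormalBasis (Fin n) ℂ (EuclideanSpace ℂ (Fin n)))
    (X : su n) :
    suPinch Finset.univ (suConj (star b.toUnitaryGroup) X) = suDiagonal n fun j =>
      (inner ℂ (b j) (Matrix.toEuclideanCLM (n := Fin n) (𝕜 := ℂ)
        (X : Matrix (Fin n) (Fin n) ℂ) (b j))).im := by
  set Y := suConj (star b.toUnitaryGroup) X with hY
  have hjj : ∀ j, inner ℂ (b j) (Matrix.toEuclideanCLM (n := Fin n) (𝕜 := ℂ)
      (X : Matrix (Fin n) (Fin n) ℂ) (b j)) = (Y : Matrix (Fin n) (Fin n) ℂ) j j := fun j =>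
    (suConj_star_apply b X j j).symm
  simp only [hjj]
  have him : ∀ j, (((Y : Matrix (Fin n) (Fin n) ℂ) j j).im : ℂ) * Complex.I =
      (Y : Matrix (Fin n) (Fin n) ℂ) j j := fun j => by
    have h := congrFun (congrFun Y.2.1 j) j
    rw [Matrix.conjTranspose_apply, Matrix.neg_apply] at h
    have hre := congrArg Complex.re h
    simp only [Complex.star_def, Complex.conj_re, Complex.neg_re] at hre
    apply Complex.ext
    · simp; linarith
    · simp
  have hsum : ∑ k, ((Y : Matrix (Fin n) (Fin n) ℂ) k k).im = 0 := by
    have := congrArg Complex.im Y.2.2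
    simpa [Matrix.trace] using this
  apply Subtype.ext
  ext j k
  rw [suDiagonal_of_sum_eq_zero hsum]
  by_cases hjk : j = k
  · subst hjk
    simp [suPinch, him]
  · simp [suPinch, hjk]

/-! ### Supporting functionals and continuity of the Finsler norm at zero -/

theorem exists_linear_le_sublinear_eq {E : Type*} [AddCommGroup E] [Module ℝ E] {p : E → ℝ}
    (hp : ∀ c : ℝ, 0 ≤ c → ∀ x, p (c • x) = c * p x) (hadd : ∀ x y, p (x + y) ≤ p x + p y) (x₀ : E) :
    ∃ g : E →ₗ[ℝ] ℝ, g x₀ = p x₀ ∧ ∀ x, g x ≤ p x := by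
  have h0 : p 0 = 0 := by simpa using hp 0 le_rfl 0
  rcases eq_or_ne x₀ 0 with rfl | hx
  · obtain ⟨g, -, hg⟩ := exists_extension_of_le_sublinear (⊥ : E →ₗ.[ℝ] ℝ) p
      (fun c hc x => hp c hc.le x) hadd (fun x => by
        have hx : (x : E) = 0 := (Submodule.mem_bot ℝ).mp x.2
        have : x = 0 := Subtype.ext hx
        simp [this, h0])
    exact ⟨g, by simp [h0], hg⟩
  · obtain ⟨g, hg, hg'⟩ := exists_extension_of_le_sublinear
      (LinearPMap.mkSpanSingleton x₀ (p x₀) hx : E →ₗ.[ℝ] ℝ) p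
      (fun c hc x => hp c hc.le x) hadd (fun x => by
        obtain ⟨x, hx'⟩ := x
        obtain ⟨c, rfl⟩ := Submodule.mem_span_singleton.mp hx'
        refine (LinearPMap.mkSpanSingleton'_apply _ _ _ _ hx').trans_le ?_
        rw [RingHom.id_apply, smul_eq_mul]
        rcases le_total 0 c with hc | hc
        · rw [hp c hc]
        · have h1 := hadd (c • x₀) ((-c) • x₀)
          rw [← add_smul, add_neg_cancel, zero_smul, h0, hp (-c) (by linarith)] at h1
          linarith)
    refine ⟨g, ?_, hg'⟩
    have := hg ⟨x₀, Submodule.mem_span_singleton_self x₀⟩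
    rw [this]
    exact LinearPMap.mkSpanSingleton_apply ℝ ℝ hx (p x₀)

/-- The weights represent a functional supporting `d ↦ N (suDiagonal n d)` at `θ`. Pinching in the
basis `b` extends the bound from diagonal matrices to all `X`. -/
theorem IsAdInvariantFinslerNorm.exists_spectral_subgradient {n : ℕ} {N : su n → ℝ}
    (hN : IsAdInvariantFinslerNorm N) (X₀ : su n)
    (v : OrthonormalBasis (Fin n) ℂ (EuclideanSpace ℂ (Fin n))) (θ : Fin n → ℝ)
    (hv : ∀ j, Matrix.toEuclideanCLM (n := Fin n) (𝕜 := ℂ) (X₀ : Matrix (Fin n) (Fin n) ℂ) (v j) =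
      ((θ j : ℂ) * Complex.I) • v j) :
    ∃ φ : Fin n → ℝ, ∑ j, φ j * θ j = N X₀ ∧
      (∀ (X : su n) (b : OrthonormalBasis (Fin n) ℂ (EuclideanSpace ℂ (Fin n))),
        ∑ j, φ j * (inner ℂ (b j) (Matrix.toEuclideanCLM (n := Fin n) (𝕜 := ℂ)
          (X : Matrix (Fin n) (Fin n) ℂ) (b j))).im ≤ N X) ∧
      ∀ j l, 0 ≤ (φ j - φ l) * (θ j - θ l) := by
  obtain ⟨g, hg, hg'⟩ := exists_linear_le_sublinear_eq (p := fun d => N (suDiagonal n d))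
    (fun c hc d => by rw [map_smul, hN.smul_eq c _ hc])
    (fun d e => by rw [map_add]; exact hN.add_le _ _) θ
  have hgsum : ∀ d, g d = ∑ j, g (Pi.single j 1) * d j := fun d => by
    rw [LinearMap.pi_apply_eq_sum_univ g d]
    refine Finset.sum_congr rfl fun j _ => ?_
    rw [smul_eq_mul, mul_comm]
    congr 2
    ext i
    simp [Pi.single_apply, eq_comm]
  have hdiag : ∀ (σ : Equiv.Perm (Fin n)), N (suDiagonal n (θ ∘ σ)) = N X₀ := fun σ => by
    rw [← hN.suConj_eq (star (v.reindex σ.symm).toUnitaryGroup) X₀]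
    congr 1
    refine (suConj_star_eq_suDiagonal fun j k => ?_).symm
    simp only [OrthonormalBasis.reindex_apply, Equiv.symm_symm, hv, inner_smul_right,
      orthonormal_iff_ite.mp v.orthonormal, Function.comp_apply, σ.injective.eq_iff]
    split_ifs with h
    · subst h; simp
    · simp
  have hid : N (suDiagonal n θ) = N X₀ := hdiag 1
  refine ⟨fun j => g (Pi.single j 1), ?_, fun X b => ?_, fun j l => ?_⟩
  · rw [← hgsum, hg, hid]
  · rw [← hgsum]
    refine (hg' _).trans ?_
    rw [← suPinch_suConj_star, ← hN.suConj_eq (star b.toUnitaryGroup) X]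
    exact hN.suPinch_le _ _
  -- Swapping two eigenvalues keeps `N` and cannot raise `g` above `g θ`; the difference of the two
  -- values is `(φ j - φ l) * (θ j - θ l)`.
  · have h1 := (hg' (θ ∘ Equiv.swap j l)).trans_eq ((hdiag _).trans (hid.symm.trans hg.symm))
    have h2 : θ ∘ Equiv.swap j l = θ - (θ j - θ l) • (Pi.single j 1 - Pi.single l 1) := by
      ext i
      rcases eq_or_ne i j with rfl | hij
      · rcases eq_or_ne i l with rfl | hil <;> simp [*]
      · rcases eq_or_ne i l with rfl | hil
        · simp [hij]
        · simp [Equiv.swap_apply_of_ne_of_ne hij hil, hij, hil]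
    rw [h2, map_sub, map_smul, map_sub, smul_eq_mul] at h1
    linarith [mul_comm (θ j - θ l) (g (Pi.single j 1) - g (Pi.single l 1))]

theorem IsAdInvariantFinslerNorm.tendsto_zero {n : ℕ} {N : su n → ℝ}
    (hN : IsAdInvariantFinslerNorm N) : Tendsto N (𝓝 0) (𝓝 0) := by
  have hz : N 0 = 0 := by simpa using hN.smul_eq 0 0 le_rfl
  let b := Module.finBasis ℝ (su n)
  -- Both `N (b i)` and `N (-b i)` enter because `N` need not be even.
  have hle : ∀ v, N v ≤ ∑ i, |b.repr v i| * (N (b i) + N (-b i)) := fun v => by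
    have hsum : ∀ s : Finset (Fin (Module.finrank ℝ (su n))),
        N (∑ i ∈ s, b.repr v i • b i) ≤ ∑ i ∈ s, |b.repr v i| * (N (b i) + N (-b i)) := fun s => by
      induction s using Finset.induction_on with
      | empty => simp [hz]
      | insert k s hk ih =>
        rw [Finset.sum_insert hk, Finset.sum_insert hk]
        refine (hN.add_le _ _).trans (add_le_add ?_ ih)
        rcases le_total 0 (b.repr v k) with h | h
        · rw [hN.smul_eq _ _ h, abs_of_nonneg h]
          nlinarith [hN.nonneg (-b k)]
        · rw [show b.repr v k • b k = (-b.repr v k) • (-b k) by simp, hN.smul_eq _ _ (by linarith), abs_of_nonpos h]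
          nlinarith [hN.nonneg (b k)]
    simpa [b.sum_repr] using hsum Finset.univ
  have hcont : Continuous fun v => ∑ i, |b.repr v i| * (N (b i) + N (-b i)) := by
    have : ∀ i, Continuous fun v => b.repr v i := fun i =>
      LinearMap.continuous_of_finiteDimensional (b.coord i)
    fun_prop
  have h0 := hcont.tendsto 0
  simp only [map_zero, Finsupp.coe_zero, Pi.zero_apply, abs_zero, zero_mul,
    Finset.sum_const_zero] at h0
  exact squeeze_zero hN.nonneg hle h0

/-! ### Exponentials in a complex Banach algebra -/

section ComplexBanachAlgebra

variable {𝔸 : Type*} [NormedRing 𝔸] [NormedAlgebra ℂ 𝔸] [CompleteSpace 𝔸]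

theorem HasTaylorTwo.exp_ofReal_smul (a : 𝔸) :
    HasTaylorTwo (fun s => NormedSpace.exp ((s : ℂ) • a)) 1 a ((2⁻¹ : ℝ) • (a * a)) := by
  simpa only [Complex.coe_smul] using HasTaylorTwo.exp_smul a

theorem exp_add_of_commute_of_complex {a b : 𝔸} (h : Commute a b) :
    NormedSpace.exp (a + b) = NormedSpace.exp a * NormedSpace.exp b :=
  let _ := NormedAlgebra.restrictScalars ℚ ℂ 𝔸
  NormedSpace.exp_add_of_commute h

theorem continuous_exp_of_complex : Continuous (NormedSpace.exp : 𝔸 → 𝔸) :=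
  let _ := NormedAlgebra.restrictScalars ℚ ℂ 𝔸
  NormedSpace.exp_continuous

theorem map_exp_of_complex {𝔹 F : Type*} [Ring 𝔹] [TopologicalSpace 𝔹] [IsTopologicalRing 𝔹]
    [T2Space 𝔹] [Algebra ℂ 𝔹] [FunLike F 𝔸 𝔹] [AlgHomClass F ℂ 𝔸 𝔹] (f : F) (hf : Continuous f)
    (a : 𝔸) : f (NormedSpace.exp a) = NormedSpace.exp (f a) := by
  rw [NormedSpace.exp_eq_tsum ℂ (𝔸 := 𝔹)]
  have h := (NormedSpace.exp_series_hasSum_exp' (𝕂 := ℂ) a).map f hf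
  simp only [Function.comp_def, map_smul, map_pow] at h
  exact h.tsum_eq.symm

theorem exp_smul_eq_exp_sub_smul_mul_exp_smul (a : 𝔸) (t t₀ : ℝ) :
    NormedSpace.exp ((t : ℂ) • a) =
      NormedSpace.exp (((t - t₀ : ℝ) : ℂ) • a) * NormedSpace.exp ((t₀ : ℂ) • a) := by
  rw [← exp_add_of_commute_of_complex (((Commute.refl a).smul_left _).smul_right _), ← add_smul,
    ← Complex.ofReal_add, sub_add_cancel]

theorem exp_ofReal_smul_mem_unitary [StarRing 𝔸] [ContinuousStar 𝔸] [StarModule ℂ 𝔸] {a : 𝔸}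
    (h : a ∈ skewAdjoint 𝔸) (s : ℝ) : NormedSpace.exp ((s : ℂ) • a) ∈ unitary 𝔸 := by
  let _ := NormedAlgebra.restrictScalars ℚ ℂ 𝔸
  refine NormedSpace.exp_mem_unitary_of_mem_skewAdjoint ?_
  rw [skewAdjoint.mem_iff, star_smul, skewAdjoint.mem_iff.mp h, smul_neg, Complex.star_def,
    Complex.conj_ofReal]

end ComplexBanachAlgebra

/-! ### Second order expansion along a perturbed eigenvector -/

section Perturbation

variable {E : Type*} [NormedAddCommGroup E] [InnerProductSpace ℂ E]

theorem isBoundedBilinearMap_clm_apply_real :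
    IsBoundedBilinearMap ℝ fun q : (E →L[ℂ] E) × E => q.1 q.2 where
  add_left := fun _ _ _ => rfl
  smul_left := fun _ _ _ => rfl
  add_right := fun A u v => map_add A u v
  smul_right := fun c A v => (A.toLinearMap).map_smul_of_tower c v
  bound := ⟨1, one_pos, fun A v => by simpa using A.le_opNorm v⟩

theorem tendsto_exp_sub_smul_apply [CompleteSpace E] (A : E →L[ℂ] E) (t₀ : ℝ) (z : E) :
    Tendsto (fun t : ℝ => NormedSpace.exp (((t - t₀ : ℝ) : ℂ) • A) z) (𝓝 t₀) (𝓝 z) := by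
  have h : Continuous fun t : ℝ => NormedSpace.exp (((t - t₀ : ℝ) : ℂ) • A) :=
    continuous_exp_of_complex.comp (by fun_prop)
  have h' : Continuous fun t : ℝ => NormedSpace.exp (((t - t₀ : ℝ) : ℂ) • A) z := by fun_prop
  simpa using h'.tendsto t₀

theorem HasTaylorTwo.cexp_add_mul_I (θ h : ℝ) :
    HasTaylorTwo (fun s : ℝ => Complex.exp ((θ + s * h : ℝ) * Complex.I))
      (Complex.exp (θ * Complex.I)) (Complex.exp (θ * Complex.I) * (h * Complex.I))
      (-(h ^ 2 / 2 : ℝ) * Complex.exp (θ * Complex.I)) := by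
  have h1 := (HasTaylorTwo.const (Complex.exp (θ * Complex.I))).bilinear
    (isBoundedBilinearMap_smul (𝕜 := ℝ) (A := ℂ) (E := ℂ)) (HasTaylorTwo.exp_smul (h * Complex.I))
  convert h1 using 1
  · ext s
    rw [← Complex.exp_eq_exp_ℂ, smul_eq_mul, ← Complex.exp_add]
    congr 1
    simp only [Complex.real_smul]
    push_cast
    ring
  · simp
  · simp
  · simp only [smul_eq_mul, Complex.real_smul, zero_mul, add_zero]
    push_cast
    linear_combination (-(h : ℂ) ^ 2 / 2 * Complex.exp (θ * Complex.I)) * Complex.I_sq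

variable [CompleteSpace E] {U x w : E →L[ℂ] E} {v : E} {θ h : ℝ}

/-- `hUv` is the eigenvector equation at order `s⁰`, and `hUw` is the same equation at order `s`;
they cancel the first two coefficients. -/
theorem hasTaylorTwo_residual (hUv : U v = Complex.exp (θ * Complex.I) • v)
    (hUw : U (w v) = Complex.exp (θ * Complex.I) • (w v - x v + (h * Complex.I) • v)) :
    HasTaylorTwo (fun s : ℝ => NormedSpace.exp ((s : ℂ) • x) (U (NormedSpace.exp ((s : ℂ) • w) v)) -
        Complex.exp ((θ + s * h : ℝ) * Complex.I) • NormedSpace.exp ((s : ℂ) • w) v) 0 0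
      (U ((2⁻¹ : ℝ) • w (w v)) + x (U (w v)) + (2⁻¹ : ℝ) • x (x (U v)) -
        (Complex.exp (θ * Complex.I) • (2⁻¹ : ℝ) • w (w v) +
          (Complex.exp (θ * Complex.I) * (h * Complex.I)) • w v +
          (-(h ^ 2 / 2 : ℝ) * Complex.exp (θ * Complex.I)) • v)) := by
  have h1 := (HasTaylorTwo.exp_ofReal_smul w).bilinear isBoundedBilinearMap_clm_apply_real
    (HasTaylorTwo.const v)
  have h2 := (HasTaylorTwo.exp_ofReal_smul x).bilinear isBoundedBilinearMap_clm_apply_real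
    (h1.clm (U.restrictScalars ℝ))
  have h3 := (HasTaylorTwo.cexp_add_mul_I θ h).bilinear
    (isBoundedBilinearMap_smul (𝕜 := ℝ) (A := ℂ) (E := E)) h1
  convert h2.sub h3 using 1
  · simp
  · simp [hUv]
  · simp only [ContinuousLinearMap.coe_restrictScalars', map_zero, zero_add, one_apply_eq_self, hUv, hUw, map_smul]
    module
  · simp

theorem isBigO_residual (hUv : U v = Complex.exp (θ * Complex.I) • v)
    (hUw : U (w v) = Complex.exp (θ * Complex.I) • (w v - x v + (h * Complex.I) • v)) :
    (fun s : ℝ => NormedSpace.exp ((s : ℂ) • x) (U (NormedSpace.exp ((s : ℂ) • w) v)) -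
        Complex.exp ((θ + s * h : ℝ) * Complex.I) • NormedSpace.exp ((s : ℂ) • w) v) =O[𝓝 0]
      fun s : ℝ => s ^ 2 :=
  (hasTaylorTwo_residual hUv hUw).isBigO_sq

/-- Subtracting the approximate eigenvalue times the vector removes only the real number `‖exp (s w)
v‖²`, so the residual may replace the image vector. As it is `O(s²)`, the other factors count only
at `s = 0`. -/
theorem im_inner_second_order (hv : ‖v‖ = 1)
    (hUv : U v = Complex.exp (θ * Complex.I) • v)
    (hUadj : ∀ z, inner ℂ v (U z) = Complex.exp (θ * Complex.I) * inner ℂ v z)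
    (hUw : U (w v) = Complex.exp (θ * Complex.I) • (w v - x v + (h * Complex.I) • v))
    (hx : ∀ y z, inner ℂ (x y) z = -inner ℂ y (x z))
    (hxv : inner ℂ v (x v) = h * Complex.I) (hwv : inner ℂ v (w v) = 0) :
    (fun s : ℝ => (Complex.exp (-((θ + s * h : ℝ) * Complex.I)) *
        inner ℂ (NormedSpace.exp ((s : ℂ) • w) v)
          (NormedSpace.exp ((s : ℂ) • x) (U (NormedSpace.exp ((s : ℂ) • w) v)))).im -
        s ^ 2 * (inner ℂ (w v) (x v)).im) =o[𝓝 0] fun s : ℝ => s ^ 2 := by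
  have h1 := (HasTaylorTwo.exp_ofReal_smul w).bilinear isBoundedBilinearMap_clm_apply_real
    (HasTaylorTwo.const v)
  have h2 := h1.bilinear (isBoundedBilinearMap_inner (𝕜 := ℂ)) (hasTaylorTwo_residual hUv hUw)
  have h3 := ((HasTaylorTwo.cexp_add_mul_I (-θ) (-h)).bilinear
    (isBoundedBilinearMap_smul (𝕜 := ℝ) (A := ℂ) (E := ℂ)) h2).clm Complex.imCLM
  set e := Complex.exp (θ * Complex.I) with he
  set e' := Complex.exp ((-θ : ℝ) * Complex.I) with he'_def
  have he' : e' * e = 1 := by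
    rw [he, he'_def, ← Complex.exp_add]
    simp
  have hvv : inner ℂ v v = 1 := by rw [inner_self_eq_norm_sq_to_K, hv]; simp
  have hxv' : inner ℂ (x v) v = -(h * Complex.I) := by rw [hx, hxv]
  have hhalf : ∀ z, inner ℂ v ((2⁻¹ : ℝ) • z) = 2⁻¹ * inner ℂ v z := fun z => by
    rw [inner_smul_right_eq_smul, Complex.real_smul]
    push_cast
    rfl
  have hcoef : (e' *
      inner ℂ v (U ((2⁻¹ : ℝ) • w (w v)) + x (U (w v)) + (2⁻¹ : ℝ) • x (x (U v)) -
        (e • (2⁻¹ : ℝ) • w (w v) + (e * (h * Complex.I)) • w v +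
          (-(h ^ 2 / 2 : ℝ) * e) • v))).im = (inner ℂ (w v) (x v)).im := by
    have h4 : inner ℂ v (x (U (w v))) =
        -(e * (inner ℂ (x v) (w v) - inner ℂ (x v) (x v) + h * Complex.I * -(h * Complex.I))) := by
      rw [← neg_eq_iff_eq_neg, ← hx, hUw, inner_smul_right, inner_add_right, inner_sub_right,
        inner_smul_right, hxv']
    have h5 : inner ℂ v (x (x (U v))) = -(e * inner ℂ (x v) (x v)) := by
      rw [← neg_eq_iff_eq_neg, ← hx, hUv, map_smul, inner_smul_right]
    -- The `w (w v)` terms cancel by `hUadj`; everything left is real except `-⟨x v, w v⟩`.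
    have h6 : e' *
        inner ℂ v (U ((2⁻¹ : ℝ) • w (w v)) + x (U (w v)) + (2⁻¹ : ℝ) • x (x (U v)) -
        (e • (2⁻¹ : ℝ) • w (w v) + (e * (h * Complex.I)) • w v +
          (-(h ^ 2 / 2 : ℝ) * e) • v)) =
        -inner ℂ (x v) (w v) + ((‖x v‖ ^ 2 / 2 - h ^ 2 / 2 : ℝ) : ℂ) := by
      rw [inner_sub_right, inner_add_right, inner_add_right, inner_add_right, inner_add_right,
        hUadj, h4, hhalf, hhalf, h5, inner_smul_right, inner_smul_right, inner_smul_right, hhalf,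
        hwv, hvv, inner_self_eq_norm_sq_to_K]
      push_cast
      linear_combination (-inner ℂ (x v) (w v) + (‖x v‖ ^ 2 / 2 + h ^ 2 / 2 : ℂ) +
        (h : ℂ) ^ 2 * Complex.I ^ 2) * he' + (h : ℂ) ^ 2 * Complex.I_sq
    rw [h6, Complex.add_im, Complex.ofReal_im, add_zero, Complex.neg_im, ← inner_conj_symm (w v)]
    rfl
  refine IsLittleO.congr_left h3 fun s => ?_
  have e1 : Complex.exp ((-θ + s * -h : ℝ) * Complex.I) =
      Complex.exp (-((θ + s * h : ℝ) * Complex.I)) := by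
    congr 1
    push_cast
    ring
  have e2 : Complex.exp (-((θ + s * h : ℝ) * Complex.I)) *
      Complex.exp ((θ + s * h : ℝ) * Complex.I) = 1 := by
    rw [← Complex.exp_add, neg_add_cancel, Complex.exp_zero]
  simp only [e1, one_apply_eq_self, inner_zero_right, mul_zero, add_zero, zero_add, map_zero,
    smul_eq_mul, Complex.imCLM_apply, hcoef]
  rw [inner_sub_right, inner_smul_right, mul_sub, ← mul_assoc (Complex.exp (-((θ + s * h : ℝ) * Complex.I))), e2, one_mul,
    inner_self_eq_norm_sq_to_K]
  have e3 : (((‖NormedSpace.exp ((s : ℂ) • w) v‖ : ℝ) : ℂ) ^ 2).im = 0 := by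
    rw [← Complex.ofReal_pow, Complex.ofReal_im]
  simp [e3, -Complex.coe_smul]

end Perturbation

/-! ### The rotation of the eigenbasis -/

section Rotation

variable {ι E : Type*} [Fintype ι] [NormedAddCommGroup E] [InnerProductSpace ℂ E]
  [FiniteDimensional ℂ E]

/-- The operator that to first order rotates the eigenvectors `v j` of `exp X`, with eigenvalues
`exp (i θ j)`, into those of `exp (s x) exp X`. -/
noncomputable def eigenRotation (v : OrthonormalBasis ι ℂ E) (θ : ι → ℝ) (x : E →L[ℂ] E) :
    E →L[ℂ] E :=
  LinearMap.toContinuousLinearMap (v.toBasis.constr ℂ fun j => ∑ l,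
    (if θ l = θ j then 0 else
      inner ℂ (v l) (x (v j)) / (1 - Complex.exp ((θ l - θ j : ℝ) * Complex.I))) • v l)

variable (v : OrthonormalBasis ι ℂ E) (θ : ι → ℝ) {x : E →L[ℂ] E}

theorem inner_eigenRotation (l j : ι) :
    inner ℂ (v l) (eigenRotation v θ x (v j)) = if θ l = θ j then 0 else
      inner ℂ (v l) (x (v j)) / (1 - Complex.exp ((θ l - θ j : ℝ) * Complex.I)) := by
  have h : eigenRotation v θ x (v j) = ∑ l, (if θ l = θ j then 0 else
      inner ℂ (v l) (x (v j)) / (1 - Complex.exp ((θ l - θ j : ℝ) * Complex.I))) • v l := by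
    have := v.toBasis.constr_basis ℂ (fun j => ∑ l, (if θ l = θ j then 0 else
      inner ℂ (v l) (x (v j)) / (1 - Complex.exp ((θ l - θ j : ℝ) * Complex.I))) • v l) j
    rwa [v.coe_toBasis] at this
  rw [h, v.orthonormal.inner_right_fintype]

theorem star_inner_eigenRotation (hx : ∀ y z, inner ℂ (x y) z = -inner ℂ y (x z)) (l j : ι) :
    star (inner ℂ (v l) (eigenRotation v θ x (v j))) =
      -inner ℂ (v j) (eigenRotation v θ x (v l)) := by
  rw [inner_eigenRotation, inner_eigenRotation]
  by_cases h : θ l = θ j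
  · simp [h]
  · rw [if_neg h, if_neg (Ne.symm h), star_div₀, star_sub, star_one, ← neg_div]
    congr 1
    · rw [Complex.star_def, inner_conj_symm, hx]
    · rw [Complex.star_def, ← Complex.exp_conj]
      congr 2
      simp
      ring

/-- Skewness makes `exp (s w)` unitary, so the rotated vectors still form an orthonormal basis. -/
theorem eigenRotation_mem_skewAdjoint (hx : ∀ y z, inner ℂ (x y) z = -inner ℂ y (x z)) :
    eigenRotation v θ x ∈ skewAdjoint (E →L[ℂ] E) := by
  rw [skewAdjoint.mem_iff]
  apply ContinuousLinearMap.coe_injective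
  refine v.toBasis.ext fun j => ?_
  rw [v.coe_toBasis]
  refine v.toBasis.ext_elem_iff.mpr fun l => ?_
  have h1 := star_inner_eigenRotation v θ hx j l
  simp only [OrthonormalBasis.coe_toBasis_repr_apply, v.repr_apply_apply]
  have h2 : inner ℂ (v l) (star (eigenRotation v θ x) (v j)) =
      inner ℂ (eigenRotation v θ x (v l)) (v j) :=
    ContinuousLinearMap.adjoint_inner_right _ _ _
  change inner ℂ (v l) (star (eigenRotation v θ x) (v j)) =
    inner ℂ (v l) (-(eigenRotation v θ x (v j)))
  rw [h2, inner_neg_right, ← h1, Complex.star_def, inner_conj_symm]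

theorem one_sub_cexp_ne_zero {α β : ℝ} (h : |α - β| ≤ Real.pi) (hne : α ≠ β) :
    1 - Complex.exp ((α - β : ℝ) * Complex.I) ≠ 0 := by
  intro h0
  have h1 := abs_sub_le_norm_cexp_sub (α := α - β) (β := 0) (by simpa using h)
  rw [← norm_neg, neg_sub, Complex.ofReal_zero, zero_mul, Complex.exp_zero, h0, norm_zero, mul_zero,
    sub_zero] at h1
  exact hne (sub_eq_zero.mp (abs_nonpos_iff.mp h1))

/-- For `l ≠ j` the `l`-th coordinate reads `(e^{iθ l} - e^{iθ j}) w l j = -e^{iθ j} x l j`. The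
bound `hθ` excludes coincidences modulo `2π`, and `hoff` settles equal eigenvalues. -/
theorem apply_eigenRotation {U : E →L[ℂ] E} {h : ι → ℝ}
    (hU : ∀ j, U (v j) = Complex.exp (θ j * Complex.I) • v j)
    (hθ : ∀ l j, |θ l - θ j| ≤ Real.pi)
    (hdiag : ∀ j, inner ℂ (v j) (x (v j)) = h j * Complex.I)
    (hoff : ∀ j l, j ≠ l → θ j = θ l → inner ℂ (v l) (x (v j)) = 0) (j : ι) :
    U (eigenRotation v θ x (v j)) = Complex.exp (θ j * Complex.I) •
      (eigenRotation v θ x (v j) - x (v j) + (h j * Complex.I) • v j) := by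
  classical
  refine v.toBasis.ext_elem_iff.mpr fun l => ?_
  simp only [OrthonormalBasis.coe_toBasis_repr_apply, v.repr_apply_apply]
  rw [v.inner_apply_of_eigenvector hU, inner_smul_right, inner_add_right, inner_sub_right,
    inner_smul_right, inner_eigenRotation, orthonormal_iff_ite.mp v.orthonormal]
  by_cases hlj : l = j
  · subst hlj
    simp [hdiag]
  · rw [if_neg hlj]
    by_cases he : θ l = θ j
    · rw [if_pos he, hoff j l (Ne.symm hlj) he.symm]
      simp
    · rw [if_neg he]
      have hne := one_sub_cexp_ne_zero (hθ l j) he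
      have hexp : Complex.exp (θ l * Complex.I) =
          Complex.exp (θ j * Complex.I) * Complex.exp ((θ l - θ j : ℝ) * Complex.I) := by
        rw [← Complex.exp_add]
        congr 1
        push_cast
        ring
      rw [hexp]
      revert hne
      generalize Complex.exp ((θ l - θ j : ℝ) * Complex.I) = z
      intro hne
      field_simp
      ring

/-- Since `x l j = w l j (1 - e^{i(θ l - θ j)})`, each product `conj (w l j) * x l j` is `|w l j|²`
times that bracket. -/
theorem im_inner_eigenRotation (hθ : ∀ l j, |θ l - θ j| ≤ Real.pi) (j : ι) :
    (inner ℂ (eigenRotation v θ x (v j)) (x (v j))).im =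
      ∑ l, ‖inner ℂ (v l) (eigenRotation v θ x (v j))‖ ^ 2 * Real.sin (θ j - θ l) := by
  rw [← v.sum_inner_mul_inner, Complex.im_sum]
  refine Finset.sum_congr rfl fun l _ => ?_
  rw [← inner_conj_symm, inner_eigenRotation]
  by_cases he : θ l = θ j
  · simp [he]
  · have hne := one_sub_cexp_ne_zero (hθ l j) he
    rw [if_neg he]
    set q := inner ℂ (v l) (x (v j)) / (1 - Complex.exp ((θ l - θ j : ℝ) * Complex.I)) with hq
    have hq' : inner ℂ (v l) (x (v j)) =
        q * (1 - Complex.exp ((θ l - θ j : ℝ) * Complex.I)) := (div_mul_cancel₀ _ hne).symm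
    rw [hq', ← mul_assoc, RCLike.conj_mul]
    have h1 : ((‖q‖ : ℂ) ^ 2 * (1 - Complex.exp ((θ l - θ j : ℝ) * Complex.I))).im =
        ‖q‖ ^ 2 * -Real.sin (θ l - θ j) := by
      rw [← Complex.ofReal_pow, Complex.im_ofReal_mul, Complex.sub_im, Complex.one_im,
        Complex.exp_ofReal_mul_I_im, zero_sub]
    refine h1.trans ?_
    rw [← Real.sin_neg, neg_sub]

theorem sum_mul_im_inner_eigenRotation_nonneg
    (hx : ∀ y z, inner ℂ (x y) z = -inner ℂ y (x z)) (hθ : ∀ l j, |θ l - θ j| ≤ Real.pi) {φ : ι → ℝ}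
    (hφ : ∀ j l, 0 ≤ (φ j - φ l) * (θ j - θ l)) :
    0 ≤ ∑ j, φ j * (inner ℂ (eigenRotation v θ x (v j)) (x (v j))).im := by
  simp only [im_inner_eigenRotation v θ hθ]
  set m : ι → ι → ℝ := fun j l => ‖inner ℂ (v l) (eigenRotation v θ x (v j))‖ ^ 2 with hm
  have hsymm : ∀ j l, m j l = m l j := fun j l => by
    have := congrArg norm (star_inner_eigenRotation v θ hx l j)
    rw [norm_star, norm_neg] at this
    simp only [hm, this]
  have h1 : ∑ j, φ j * ∑ l, m j l * Real.sin (θ j - θ l) =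
      ∑ j, ∑ l, φ j * (m j l * Real.sin (θ j - θ l)) := by
    simp only [Finset.mul_sum]
  -- Exchanging `j` and `l` flips the sine and keeps `m`, so twice the sum has the factor `φ j - φ
  -- l`, whose sign agrees with the sine's.
  have h2 : ∑ j, ∑ l, φ j * (m j l * Real.sin (θ j - θ l)) =
      ∑ j, ∑ l, -(φ l * (m j l * Real.sin (θ j - θ l))) := by
    rw [Finset.sum_comm]
    refine Finset.sum_congr rfl fun j _ => Finset.sum_congr rfl fun l _ => ?_
    rw [hsymm l j, ← neg_sub (θ j), Real.sin_neg]
    ring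
  have h3 : 0 ≤ ∑ j, ∑ l, (φ j - φ l) * (m j l * Real.sin (θ j - θ l)) := by
    refine Finset.sum_nonneg fun j _ => Finset.sum_nonneg fun l _ => ?_
    have hm0 : 0 ≤ m j l := by positivity
    rw [mul_left_comm]
    refine mul_nonneg hm0 ?_
    have hb := abs_le.mp (hθ j l)
    rcases lt_trichotomy (θ j) (θ l) with hlt | heq | hgt
    · have hs : Real.sin (θ j - θ l) ≤ 0 :=
        Real.sin_nonpos_of_nonpos_of_neg_pi_le (by linarith) (by linarith)
      have : φ j - φ l ≤ 0 := by
        by_contra hcon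
        have := hφ j l
        nlinarith
      exact mul_nonneg_of_nonpos_of_nonpos this hs
    · simp [heq]
    · have hs : 0 ≤ Real.sin (θ j - θ l) :=
        Real.sin_nonneg_of_nonneg_of_le_pi (by linarith) (by linarith)
      have : 0 ≤ φ j - φ l := by
        by_contra hcon
        have := hφ j l
        nlinarith
      exact mul_nonneg this hs
  have h4 : ∑ j, ∑ l, (φ j - φ l) * (m j l * Real.sin (θ j - θ l)) =
      ∑ j, ∑ l, φ j * (m j l * Real.sin (θ j - θ l)) +
        ∑ j, ∑ l, -(φ l * (m j l * Real.sin (θ j - θ l))) := by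
    simp only [← Finset.sum_add_distrib]
    refine Finset.sum_congr rfl fun j _ => Finset.sum_congr rfl fun l _ => ?_
    ring
  rw [h1]
  linarith

end Rotation

/-! ### Transfer to `su(n)` and conclusion -/

/-- The operator on `ℂⁿ` given by an element of `su(n)`. -/
noncomputable abbrev suOp {n : ℕ} (X : su n) :
    EuclideanSpace ℂ (Fin n) →L[ℂ] EuclideanSpace ℂ (Fin n) :=
  Matrix.toEuclideanCLM (n := Fin n) (𝕜 := ℂ) (X : Matrix (Fin n) (Fin n) ℂ)

theorem suOp_inner {n : ℕ} (X : su n) (y z : EuclideanSpace ℂ (Fin n)) :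
    inner ℂ (suOp X y) z = -inner ℂ y (suOp X z) := by
  have h : star (suOp X) = -suOp X := by
    rw [← map_star, Matrix.star_eq_conjTranspose, X.2.1, map_neg]
  have h1 : inner ℂ (star (suOp X) y) z = inner ℂ y (suOp X z) :=
    ContinuousLinearMap.adjoint_inner_left _ _ _
  rw [← h1, h, neg_apply, inner_neg_left, neg_neg]

theorem isSymmetric_neg_I_smul_suOp {n : ℕ} (X : su n) :
    ((-Complex.I • suOp X : EuclideanSpace ℂ (Fin n) →L[ℂ] EuclideanSpace ℂ (Fin n)) :
      EuclideanSpace ℂ (Fin n) →ₗ[ℂ] EuclideanSpace ℂ (Fin n)).IsSymmetric := fun y z => by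
  simp [inner_smul_left, inner_smul_right, suOp_inner]

theorem exists_eigenbasis_suOp {n : ℕ} (X x : su n) :
    ∃ (v : OrthonormalBasis (Fin n) ℂ (EuclideanSpace ℂ (Fin n))) (θ : Fin n → ℝ),
      (∀ j, suOp X (v j) = (θ j * Complex.I) • v j) ∧
      (∀ j, |θ j| ≤ matrixSpectralNorm (X : Matrix (Fin n) (Fin n) ℂ)) ∧
      ∀ j l, j ≠ l → θ j = θ l → inner ℂ (v l) (suOp x (v j)) = 0 := by
  obtain ⟨v, θ, hv, hoff⟩ := (isSymmetric_neg_I_smul_suOp X).exists_eigenbasis_compression_diagonal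
    (finrank_euclideanSpace_fin (𝕜 := ℂ)) (isSymmetric_neg_I_smul_suOp x)
  have hv' : ∀ j, suOp X (v j) = (θ j * Complex.I) • v j := fun j => by
    have h : -Complex.I • suOp X (v j) = (θ j : ℂ) • v j := hv j
    rw [mul_comm, mul_smul, ← h, smul_smul, mul_neg, Complex.I_mul_I, neg_neg, one_smul]
  refine ⟨v, θ, hv', fun j => ?_, fun j l hjl hθ => ?_⟩
  · have h := (suOp X).le_opNorm (v j)
    rw [hv', norm_smul, v.norm_eq_one, mul_one, mul_one, norm_mul, Complex.norm_I, mul_one,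
      Complex.norm_real] at h
    exact h
  · have h : inner ℂ (v l) (-Complex.I • suOp x (v j)) = 0 := hoff j l hjl hθ
    rw [inner_smul_right] at h
    exact (mul_eq_zero.mp h).resolve_left (neg_ne_zero.mpr Complex.I_ne_zero)

theorem Matrix.toEuclideanCLM_exp {n : ℕ} (M : Matrix (Fin n) (Fin n) ℂ) :
    Matrix.toEuclideanCLM (n := Fin n) (𝕜 := ℂ) (NormedSpace.exp M) =
      NormedSpace.exp (Matrix.toEuclideanCLM (n := Fin n) (𝕜 := ℂ) M) := by
  let Φ := Matrix.toEuclideanCLM (n := Fin n) (𝕜 := ℂ)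
  -- `map_exp_of_complex` wants a normed source, so it is applied to the inverse, from operators to
  -- matrices.
  have hc : Continuous Φ.symm :=
    LinearMap.continuous_of_finiteDimensional
      ((Φ.symm : (EuclideanSpace ℂ (Fin n) →L[ℂ] EuclideanSpace ℂ (Fin n)) →ₗ[ℂ]
        Matrix (Fin n) (Fin n) ℂ))
  have h := map_exp_of_complex Φ.symm hc (Φ M)
  rw [StarAlgEquiv.symm_apply_apply] at h
  change Φ (NormedSpace.exp M) = NormedSpace.exp (Φ M)
  rw [← h, StarAlgEquiv.apply_symm_apply]

/-- The factor `exp y` is absorbed into `exp X₀`, so any time can serve as the origin. -/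
theorem exp_suOp_eq {n : ℕ} {x y X X₀ : su n} {t t₀ : ℝ}
    (h : NormedSpace.exp (t • (x : Matrix (Fin n) (Fin n) ℂ)) *
      NormedSpace.exp (y : Matrix (Fin n) (Fin n) ℂ) =
        NormedSpace.exp (X : Matrix (Fin n) (Fin n) ℂ))
    (h₀ : NormedSpace.exp (t₀ • (x : Matrix (Fin n) (Fin n) ℂ)) *
      NormedSpace.exp (y : Matrix (Fin n) (Fin n) ℂ) =
        NormedSpace.exp (X₀ : Matrix (Fin n) (Fin n) ℂ)) :
    NormedSpace.exp (suOp X) =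
      NormedSpace.exp (((t - t₀ : ℝ) : ℂ) • suOp x) * NormedSpace.exp (suOp X₀) := by
  have hs : ∀ r : ℝ, Matrix.toEuclideanCLM (n := Fin n) (𝕜 := ℂ)
      (r • (x : Matrix (Fin n) (Fin n) ℂ)) = (r : ℂ) • suOp x := fun r => by
    rw [← Complex.coe_smul, map_smul]
  rw [← Matrix.toEuclideanCLM_exp, ← Matrix.toEuclideanCLM_exp, ← h, ← h₀, map_mul, map_mul,
    Matrix.toEuclideanCLM_exp, Matrix.toEuclideanCLM_exp, Matrix.toEuclideanCLM_exp, hs, hs,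
    ← mul_assoc]
  exact congrArg (· * _) (exp_smul_eq_exp_sub_smul_mul_exp_smul (suOp x) t t₀)

theorem tendsto_su_of_tendsto_suOp_apply {n : ℕ} {α : Type*} {l : Filter α} {X : α → su n}
    {X₀ : su n} (v : OrthonormalBasis (Fin n) ℂ (EuclideanSpace ℂ (Fin n)))
    (h : ∀ j, Tendsto (fun a => suOp (X a) (v j)) l (𝓝 (suOp X₀ (v j)))) :
    Tendsto X l (𝓝 X₀) := by
  let L : (Fin n → EuclideanSpace ℂ (Fin n)) →ₗ[ℂ] Matrix (Fin n) (Fin n) ℂ :=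
    ((Matrix.toEuclideanCLM (n := Fin n) (𝕜 := ℂ)).symm :
        _ →ₗ[ℂ] Matrix (Fin n) (Fin n) ℂ) ∘ₗ
      LinearMap.toContinuousLinearMap.toLinearMap ∘ₗ (v.toBasis.constr ℂ).toLinearMap
  have hL : ∀ Y : su n, L (fun j => suOp Y (v j)) = Y := fun Y => by
    have h1 : v.toBasis.constr ℂ (fun j => suOp Y (v j)) =
        (suOp Y : EuclideanSpace ℂ (Fin n) →ₗ[ℂ] EuclideanSpace ℂ (Fin n)) :=
      v.toBasis.ext fun j => by simp
    change (Matrix.toEuclideanCLM (n := Fin n) (𝕜 := ℂ)).symm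
      (LinearMap.toContinuousLinearMap (v.toBasis.constr ℂ (fun j => suOp Y (v j)))) = Y
    rw [h1, StarAlgEquiv.symm_apply_eq]
    ext1
    rfl
  have hc : Continuous L := LinearMap.continuous_of_finiteDimensional L
  have h2 := (hc.tendsto _).comp (tendsto_pi_nhds.mpr h)
  rw [tendsto_subtype_rng]
  refine (h2.congr fun a => hL (X a)).trans ?_
  rw [hL]

theorem IsAdInvariantFinslerNorm.continuous {n : ℕ} {N : su n → ℝ}
    (hN : IsAdInvariantFinslerNorm N) : Continuous N := by
  refine continuous_iff_continuousAt.mpr fun v => ?_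
  have h1 : Tendsto (fun w => N (w - v)) (𝓝 v) (𝓝 0) :=
    hN.tendsto_zero.comp (tendsto_sub_nhds_zero_iff.mpr tendsto_id)
  have h2 : Tendsto (fun w => N (v - w)) (𝓝 v) (𝓝 0) :=
    hN.tendsto_zero.comp (by simpa using (tendsto_const_nhds (x := v)).sub (tendsto_id (x := 𝓝 v)))
  refine tendsto_of_tendsto_of_tendsto_of_le_of_le (g := fun w => N v - N (v - w))
    (h := fun w => N v + N (w - v)) (by simpa using h2.const_sub (N v))
    (by simpa using h1.const_add (N v)) (fun w => ?_) (fun w => ?_)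
  · have := hN.add_le (v - w) w
    rw [sub_add_cancel] at this
    linarith
  · have := hN.add_le v (w - v)
    rw [add_sub_cancel] at this
    linarith

/-- Eigenvectors of `X t₀` are nearly eigenvectors of `exp (X t)` for `t` near `t₀`, hence of `X t`
by `norm_sub_le_norm_exp_sub`. -/
theorem continuousOn_of_exp_mul_exp_eq_exp {n : ℕ} {x y : su n} {S : Set ℝ} {X : ℝ → su n}
    (hX : ∀ t ∈ S, NormedSpace.exp (t • (x : Matrix (Fin n) (Fin n) ℂ)) *
      NormedSpace.exp (y : Matrix (Fin n) (Fin n) ℂ) =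
        NormedSpace.exp (X t : Matrix (Fin n) (Fin n) ℂ))
    (hπ : ∀ t ∈ S, matrixSpectralNorm (X t : Matrix (Fin n) (Fin n) ℂ) ≤ Real.pi / 2) :
    ContinuousOn X S := by
  intro t₀ ht₀
  obtain ⟨v, θ, hv, hθ, -⟩ := exists_eigenbasis_suOp (X t₀) 0
  refine tendsto_su_of_tendsto_suOp_apply v fun j => ?_
  have hbound : ∀ t ∈ S, ‖suOp (X t) (v j) - suOp (X t₀) (v j)‖ ≤ Real.pi / 2 *
      ‖NormedSpace.exp (((t - t₀ : ℝ) : ℂ) • suOp x) (NormedSpace.exp (suOp (X t₀)) (v j)) -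
        NormedSpace.exp (suOp (X t₀)) (v j)‖ := fun t ht => by
    obtain ⟨b, μ, hb, hμ, -⟩ := exists_eigenbasis_suOp (X t) 0
    have h1 := b.norm_sub_le_norm_exp_sub hb (fun k => (hμ k).trans (hπ t ht))
      ((hθ j).trans (hπ t₀ ht₀)) (v j)
    rw [exp_suOp_eq (hX t ht) (hX t₀ ht₀), mul_apply_eq_comp] at h1
    rw [hv]
    rwa [← ContinuousLinearMap.exp_apply_of_eigenvector (hv j)] at h1
  have h0 : Tendsto (fun t : ℝ => Real.pi / 2 *
      ‖NormedSpace.exp (((t - t₀ : ℝ) : ℂ) • suOp x) (NormedSpace.exp (suOp (X t₀)) (v j)) -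
        NormedSpace.exp (suOp (X t₀)) (v j)‖) (𝓝 t₀) (𝓝 0) := by
    simpa using ((tendsto_exp_sub_smul_apply (suOp x) t₀
      (NormedSpace.exp (suOp (X t₀)) (v j))).sub_const
        (NormedSpace.exp (suOp (X t₀)) (v j))).norm.const_mul (Real.pi / 2)
  rw [tendsto_iff_norm_sub_tendsto_zero]
  refine squeeze_zero' (Eventually.of_forall fun _ => norm_nonneg _) ?_
    (h0.mono_left nhdsWithin_le_nhds)
  filter_upwards [self_mem_nhdsWithin] with t ht using hbound t ht

theorem im_inner_rotated_isLittleO {n : ℕ} {x : su n} {X : ℝ → su n}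
    (hX : ∀ᶠ s : ℝ in 𝓝 0, NormedSpace.exp (suOp (X s)) =
      NormedSpace.exp ((s : ℂ) • suOp x) * NormedSpace.exp (suOp (X 0)))
    (hπ : ∀ᶠ s in 𝓝 0, matrixSpectralNorm (X s : Matrix (Fin n) (Fin n) ℂ) < Real.pi / 2)
    {v : OrthonormalBasis (Fin n) ℂ (EuclideanSpace ℂ (Fin n))} {θ : Fin n → ℝ}
    (hv : ∀ j, suOp (X 0) (v j) = (θ j * Complex.I) • v j)
    (hθ : ∀ j, |θ j| < Real.pi / 2)
    (hoff : ∀ j l, j ≠ l → θ j = θ l → inner ℂ (v l) (suOp x (v j)) = 0) (j : Fin n) :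
    (fun s : ℝ => (inner ℂ (NormedSpace.exp ((s : ℂ) • eigenRotation v θ (suOp x)) (v j))
        (suOp (X s) (NormedSpace.exp ((s : ℂ) • eigenRotation v θ (suOp x)) (v j)))).im -
          (θ j + s * (inner ℂ (v j) (suOp x (v j))).im +
            s ^ 2 * (inner ℂ (eigenRotation v θ (suOp x) (v j)) (suOp x (v j))).im)) =o[𝓝 0]
      fun s : ℝ => s ^ 2 := by
  set w := eigenRotation v θ (suOp x) with hw
  set U := NormedSpace.exp (suOp (X 0)) with hU_def
  set h : Fin n → ℝ := fun j => (inner ℂ (v j) (suOp x (v j))).im with hh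
  have hU : ∀ j, U (v j) = Complex.exp (θ j * Complex.I) • v j := fun j =>
    ContinuousLinearMap.exp_apply_of_eigenvector (hv j)
  have hθ' : ∀ l j, |θ l - θ j| ≤ Real.pi := fun l j => by
    have := abs_sub (θ l) (θ j)
    linarith [hθ l, hθ j]
  have hdiag : ∀ j, inner ℂ (v j) (suOp x (v j)) = h j * Complex.I := fun j => by
    have h1 := suOp_inner x (v j) (v j)
    rw [← inner_conj_symm] at h1
    have h2 := congrArg Complex.re h1
    simp only [Complex.conj_re, Complex.neg_re] at h2
    apply Complex.ext
    · simp; linarith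
    · simp [hh]
  have hUw := apply_eigenRotation v θ hU hθ' hdiag hoff j
  have hwv : inner ℂ (v j) (w (v j)) = 0 := by
    rw [hw, inner_eigenRotation, if_pos rfl]
  have hρ := isBigO_residual (hU j) hUw
  have hG := im_inner_second_order (v.norm_eq_one j) (hU j)
    (fun z => v.inner_apply_of_eigenvector hU j z) hUw (suOp_inner x) (hdiag j) hwv
  have hρ2 : (fun s : ℝ => 2 * (Real.pi / 2 *
      ‖NormedSpace.exp ((s : ℂ) • suOp x) (U (NormedSpace.exp ((s : ℂ) • w) (v j))) -
        Complex.exp ((θ j + s * h j : ℝ) * Complex.I) • NormedSpace.exp ((s : ℂ) • w) (v j)‖) ^ 2)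
      =o[𝓝 0] fun s : ℝ => s ^ 2 := by
    have h4 : (fun s : ℝ => (s ^ 2) ^ 2) =o[𝓝 0] fun s : ℝ => s ^ 2 := by
      simpa only [← pow_mul] using isLittleO_pow_pow (show 2 < 2 * 2 by norm_num)
    exact (((hρ.norm_left.const_mul_left (Real.pi / 2)).pow 2).const_mul_left 2).trans_isLittleO h4
  refine IsBigO.trans_isLittleO (IsBigO.of_bound 1 ?_) (hρ2.add hG.norm_left)
  -- Strictness of the bound at `s = 0` keeps the approximate eigenvalue within the range of the
  -- chord estimate.
  have hα : ∀ᶠ s : ℝ in 𝓝 0, |θ j + s * h j| < Real.pi / 2 := by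
    have hc : Continuous fun s : ℝ => |θ j + s * h j| := by fun_prop
    have h0 := hc.tendsto 0
    simp only [zero_mul, add_zero] at h0
    exact h0.eventually_lt_const (hθ j)
  filter_upwards [hX, hπ, hα] with s hXs hπs hαs
  obtain ⟨b, μ, hb, hμ, -⟩ := exists_eigenbasis_suOp (X s) 0
  set v' := NormedSpace.exp ((s : ℂ) • w) (v j) with hv'
  have hv'_norm : ‖v'‖ = 1 := by
    have hu := exp_ofReal_smul_mem_unitary (eigenRotation_mem_skewAdjoint v θ (suOp_inner x)) s
    rw [hv', ← v.norm_eq_one j]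
    exact (Unitary.linearIsometryEquiv ⟨_, hu⟩).norm_map (v j)
  have h1 := b.norm_sub_le_norm_exp_sub hb (fun k => (hμ k).trans hπs.le) hαs.le v'
  have h2 := b.abs_im_inner_sub_le hb (θ j + s * h j) v'
  rw [hXs, mul_apply_eq_comp] at h1 h2
  rw [hv'_norm, one_pow, mul_one] at h2
  have h3 : 2 * ‖suOp (X s) v' - ((θ j + s * h j : ℝ) * Complex.I) • v'‖ ^ 2 ≤ 2 * (Real.pi / 2 *
      ‖NormedSpace.exp ((s : ℂ) • suOp x) (U v') -
        Complex.exp ((θ j + s * h j : ℝ) * Complex.I) • v'‖) ^ 2 := by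
    gcongr
  rw [one_mul, Real.norm_eq_abs, Real.norm_eq_abs, Real.norm_eq_abs]
  refine le_trans ?_ (le_abs_self _)
  refine le_trans ?_ (add_le_add_left (h2.trans h3) _)
  refine le_trans (le_of_eq ?_) (abs_add_le _ _)
  congr 1
  ring

theorem IsAdInvariantFinslerNorm.quadratic_support {n : ℕ} {N : su n → ℝ}
    (hN : IsAdInvariantFinslerNorm N) {x : su n} {X : ℝ → su n}
    (hX : ∀ᶠ s : ℝ in 𝓝 0, NormedSpace.exp (suOp (X s)) =
      NormedSpace.exp ((s : ℂ) • suOp x) * NormedSpace.exp (suOp (X 0)))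
    (hπ : ∀ᶠ s in 𝓝 0, matrixSpectralNorm (X s : Matrix (Fin n) (Fin n) ℂ) < Real.pi / 2) :
    ∃ c : ℝ, ∀ ε > 0, ∀ᶠ s in 𝓝 (0 : ℝ), N (X 0) + c * s - ε * s ^ 2 ≤ N (X s) := by
  obtain ⟨v, θ, hv, hθ, hoff⟩ := exists_eigenbasis_suOp (X 0) x
  have hθ2 : ∀ j, |θ j| < Real.pi / 2 := fun j => (hθ j).trans_lt hπ.self_of_nhds
  have hθ' : ∀ l j, |θ l - θ j| ≤ Real.pi := fun l j => by
    have := abs_sub (θ l) (θ j)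
    linarith [hθ2 l, hθ2 j]
  obtain ⟨φ, hφ0, hφ, hφθ⟩ := hN.exists_spectral_subgradient (X 0) v θ hv
  have hκ := sum_mul_im_inner_eigenRotation_nonneg v θ (suOp_inner x) hθ' hφθ
  have hR := IsLittleO.sum fun j (_ : j ∈ Finset.univ) =>
    (im_inner_rotated_isLittleO hX hπ hv hθ2 hoff j).const_mul_left (φ j)
  -- The slope is the weighted sum of the first order terms; `ε` absorbs the `o(s²)` error, and the
  -- nonnegative second order term is dropped.
  refine ⟨∑ j, φ j * (inner ℂ (v j) (suOp x (v j))).im, fun ε hε => ?_⟩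
  filter_upwards [hR.def hε] with s hs
  have hu := exp_ofReal_smul_mem_unitary (eigenRotation_mem_skewAdjoint v θ (suOp_inner x)) s
  have hle := hφ (X s) (v.map (Unitary.linearIsometryEquiv ⟨_, hu⟩))
  have hmap : ∀ j, v.map (Unitary.linearIsometryEquiv ⟨_, hu⟩) j =
      NormedSpace.exp ((s : ℂ) • eigenRotation v θ (suOp x)) (v j) := fun j => rfl
  simp only [hmap] at hle
  rw [Real.norm_eq_abs, Real.norm_eq_abs, abs_of_nonneg (sq_nonneg s)] at hs
  have hs' := (abs_le.mp hs).1
  simp only [Finset.sum_apply, mul_sub, mul_add, Finset.sum_sub_distrib, Finset.sum_add_distrib,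
    hφ0] at hs'
  have e1 : ∑ j, φ j * (s * (inner ℂ (v j) (suOp x (v j))).im) =
      (∑ j, φ j * (inner ℂ (v j) (suOp x (v j))).im) * s := by
    rw [Finset.sum_mul]
    exact Finset.sum_congr rfl fun j _ => by ring
  have e2 : ∑ j, φ j * (s ^ 2 * (inner ℂ (eigenRotation v θ (suOp x) (v j)) (suOp x (v j))).im) =
      s ^ 2 * ∑ j, φ j * (inner ℂ (eigenRotation v θ (suOp x) (v j)) (suOp x (v j))).im := by
    rw [Finset.mul_sum]
    exact Finset.sum_congr rfl fun j _ => by ring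
  rw [e1, e2] at hs'
  have := mul_nonneg (sq_nonneg s) hκ
  linarith

theorem theorem5p6 (n : ℕ) (x y : su n) (t₁ t₂ : ℝ) (X : ℝ → su n)
    (hX : ∀ t ∈ Set.Icc t₁ t₂,
      NormedSpace.exp (t • (x : Matrix (Fin n) (Fin n) ℂ)) *
          NormedSpace.exp (y : Matrix (Fin n) (Fin n) ℂ) =
        NormedSpace.exp (X t : Matrix (Fin n) (Fin n) ℂ))
    (hπ : ∀ t ∈ Set.Icc t₁ t₂,
      matrixSpectralNorm (X t : Matrix (Fin n) (Fin n) ℂ) < Real.pi / 2)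
    (N : su n → ℝ) (hN : IsAdInvariantFinslerNorm N) :
    ConvexOn ℝ (Set.Icc t₁ t₂) (fun t => N (X t)) := by
  refine convexOn_of_quadratic_support (hN.continuous.comp_continuousOn
    (continuousOn_of_exp_mul_exp_eq_exp hX fun t ht => (hπ t ht).le)) fun t ht => ?_
  have hmem : ∀ᶠ s : ℝ in 𝓝 0, t + s ∈ Set.Icc t₁ t₂ := by
    have h0 : Tendsto (fun s : ℝ => t + s) (𝓝 0) (𝓝 t) := by
      simpa using (continuous_const_add t).tendsto 0
    exact h0.eventually (Icc_mem_nhds ht.1 ht.2)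
  have := hN.quadratic_support (x := x) (X := fun s => X (t + s)) (by
    filter_upwards [hmem] with s hs
    have h := exp_suOp_eq (hX (t + s) hs) (hX t (Set.Ioo_subset_Icc_self ht))
    rw [add_sub_cancel_left] at h
    simpa only [add_zero] using h) (by
    filter_upwards [hmem] with s hs using hπ _ hs)
  simpa only [add_zero] using this
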